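/- Let $\gamma>0$ and $p>0$, and let $F$ be a probability distribution function on $\mathbb R$ with $F(1-)=0$ and $1-F(x)=x^{-1/\gamma}L(x)$ for $0<x<\infty$, where $L$ is slowly varying at infinity. Let $k_n$ be integers with $1\le k_n<n$ (for $n\ge 2$), $k_n\to\infty$ and $k_n/n\to0$ as $n\to\infty$. Let $\bar L$ be a non-negative continuous function on $(0,1)$ (generating weights $d_{i,n}=n\int_{(i-1)/n}^{i/n}\bar L(t)\,dt$) such that (a) $\bar L(1-t)=t^{\rho}\bar\ell(t)$ on $(0,1)$ for a constant $\rho>-1/2$ and a function $\bar\ell$ slowly varying at $0$, and $\bar\ell'(t)=t^{-1}\bar\ell(t)\varepsilon(t)$ on some $(0,\delta)$ with a continuous function $\varepsilon$ for which $\varepsilon(t)\to0$ as $t\downarrow0$; (b) for all $M\ge1$, $$\sup_{1/M<y<M}\left|\int_0^y\frac{(\bar\ell(u/n)-\bar\ell(y/n))u^\rho}{\bar\ell(y/n)y^\rho}\,du\right|\to0,\qquad n\to\infty .$$ Put $Q(s)=\inf\{x:F(x)\ge s\}$ for $0<s<1$, $J(s)=s^\rho\bar\ell(s)$ for $0<s<1$,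 $g(t)=-(\log Q(1-t-))^p$ for $0<t<1$, where $Q(1-t-)$ denotes the left-continuous version of the function $t\mapsto Q(1-t)$, and $K(t)=\int_{1/2}^tJ(s)\,dg(s)$ for $0<t<1$. For $0<s\le t<1$ let $\sigma(s,t)\ge 0$ be given by $$\sigma^2(s,t)=\int_s^t\int_s^t(\min(u,v)-uv)\,dK(u)\,dK(v).$$ Here integrals with respect to the left-continuous integrators $g$ and $K$ are Lebesgue--Stieltjes integrals with $\int_a^b=\int_{[a,b)}$. Let $$\mu_n=-n\int_0^{k_n/n}J(u)g(u)\,du,\qquad \alpha_n=\frac{k_n}{\rho+1}\,J\!\left(\frac{k_n}n\right)\left(\log\frac n{k_n}\right)^p .$$ Then, as $n\to\infty$, $$\sigma\!\left(\frac1n,\frac{k_n}n\right)\sim p\gamma^p\left(\frac2{(1+\rho)(1+2\rho)}\right)^{1/2}\left(\frac{k_n}n\right)^{\rho+1/2}\left(\log\frac n{k_n}\right)^{p-1}\bar\ell\!\left(\frac{k_n}n\right)\qquad\text{and}\qquad \mu_n\sim\gamma^p\alpha_n,$$ where $x_n\sim y_n$ means that $x_n/y_n\to1$. -/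

import Mathlib

open Set Filter Topology MeasureTheory ProbabilityTheory

noncomputable section

namespace PowerSums

/-- `L` is slowly varying at infinity: positive and measurable on some `[A, ∞)`, `A > 0`, and
`L (c x) / L x → 1` as `x → ∞` for every `c > 0`. -/
def SlowlyVaryingAtTop (L : ℝ → ℝ) : Prop :=
  ∃ A : ℝ, 0 < A ∧ (∀ x ∈ Ici A, 0 < L x) ∧ Measurable (fun x : Ici A => L x) ∧
    ∀ c : ℝ, 0 < c → Tendsto (fun x => L (c * x) / L x) atTop (𝓝 1)

/-- `f` is slowly varying at zero (from the right): positive and measurable on some `(0, δ)`,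
and `f (c t) / f t → 1` as `t ↓ 0` for every `c > 0`. -/
def SlowlyVaryingAtZero (f : ℝ → ℝ) : Prop :=
  ∃ δ : ℝ, 0 < δ ∧ (∀ t ∈ Ioo 0 δ, 0 < f t) ∧ Measurable (fun t : Ioo 0 δ => f t) ∧
    ∀ c : ℝ, 0 < c → Tendsto (fun t => f (c * t) / f t) (𝓝[>] 0) (𝓝 1)

/-- The distribution function `F` of the law `P` belongs to the class `𝓡_γ`, with the standing
normalization `F(1-) = 0`. -/
def MemR (γ : ℝ) (P : Measure ℝ) : Prop :=
  (∃ L : ℝ → ℝ, SlowlyVaryingAtTop L ∧ ∀ x : ℝ, 0 < x → 1 - cdf P x = x ^ (-(1 / γ)) * L x) ∧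
    Function.leftLim (cdf P) 1 = 0

/-- The quantile function `Q(s) = inf {x : F(x) ≥ s}`, used for `0 < s < 1` only
(where the set is non-empty and bounded below). -/
def quantile (P : Measure ℝ) (s : ℝ) : ℝ := sInf {x : ℝ | s ≤ cdf P x}

/-- `g(t) = -(log Q(1-t-))^p`, where `Q(1-t-)` is the left-continuous version of `t ↦ Q(1-t)`. -/
def gFun (P : Measure ℝ) (p t : ℝ) : ℝ :=
  -(Real.log (Function.leftLim (fun s => quantile P (1 - s)) t)) ^ p

/-- `J(s) = s^ρ ℓ̄(s)`. -/
def JFun (ρ : ℝ) (lbar : ℝ → ℝ) (s : ℝ) : ℝ := s ^ ρ * lbar s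

/-- `g` restricted to `[a, b]` and continued by constants to the left of `a` and the right of
`b` (for `a ≤ b`). -/
def clamp (g : ℝ → ℝ) (a b x : ℝ) : ℝ := g (max a (min b x))

open Classical in
/-- The Lebesgue-Stieltjes measure `dg` on `[a, b)`, for a function `g` that is non-decreasing and
left continuous on `[a, b]`: it gives mass `g y - g x` to `[x, y)` for `a ≤ x ≤ y ≤ b`
(see `lsMeasure_Ico`). -/
def lsMeasure (g : ℝ → ℝ) (a b : ℝ) : Measure ℝ :=
  if h : Monotone (clamp g a b) then h.stieltjesFunction.measure else 0

/-- The defining property of the Lebesgue-Stieltjes measure of a left continuous integrator. -/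
theorem lsMeasure_Ico {g : ℝ → ℝ} {a b x y : ℝ} (hg : MonotoneOn g (Icc a b))
    (hc : ∀ t ∈ Ioc a b, ContinuousWithinAt g (Iio t) t)
    (hax : a ≤ x) (hxy : x ≤ y) (hyb : y ≤ b) :
    lsMeasure g a b (Ico x y) = ENNReal.ofReal (g y - g x) := by
  have hab : a ≤ b := hax.trans (hxy.trans hyb)
  have hm : Monotone (clamp g a b) := fun u v huv =>
    hg ⟨le_max_left _ _, max_le hab (min_le_left _ _)⟩
      ⟨le_max_left _ _, max_le hab (min_le_left _ _)⟩
      (max_le_max le_rfl (min_le_min le_rfl huv))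
  have key : ∀ t ∈ Icc a b, Function.leftLim hm.stieltjesFunction t = g t := by
    intro t ht
    have h1 : Function.leftLim hm.stieltjesFunction t = Function.leftLim (clamp g a b) t := by
      have : (hm.stieltjesFunction : ℝ → ℝ) = Function.rightLim (clamp g a b) := by
        funext z; exact hm.stieltjesFunction_eq z
      rw [this]
      exact leftLim_rightLim (hm.tendsto_leftLim t)
    rw [h1]
    have hct : clamp g a b t = g t := by
      simp [clamp, min_eq_right ht.2, max_eq_right ht.1]
    have hcont : ContinuousWithinAt (clamp g a b) (Iio t) t := by
      rcases ht.1.eq_or_lt with h | h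
      · have hev : ∀ z ∈ Iio t, clamp g a b z = clamp g a b t := by
          intro z hz
          have hz' : z ≤ a := by rw [h]; exact le_of_lt hz
          simp [clamp, ← h, hab, min_eq_right (hz'.trans hab), hz']
        exact (continuousWithinAt_const (b := clamp g a b t)).congr hev rfl
      · have hev : clamp g a b =ᶠ[𝓝[<] t] g := by
          filter_upwards [Ioo_mem_nhdsLT h] with z hz
          simp [clamp, min_eq_right (hz.2.le.trans ht.2), max_eq_right hz.1.le]
        exact (hc t ⟨h, ht.2⟩).congr_of_eventuallyEq hev hct
    exact (leftLim_eq_of_tendsto hcont).trans hct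
  have e : lsMeasure g a b = hm.stieltjesFunction.measure := dif_pos hm
  have kx := key x ⟨hax, hxy.trans hyb⟩
  have ky := key y ⟨hax.trans hxy, hyb⟩
  have h2 := hm.stieltjesFunction.measure_Ico x y
  rw [kx, ky] at h2
  rw [e]
  exact h2

/-- `∫_a^b h dg = ∫_{[a,b)} h dg` for `a ≤ b` and a non-decreasing left continuous `g`. -/
def lsIntegral (h g : ℝ → ℝ) (a b : ℝ) : ℝ := ∫ x in Ico a b, h x ∂(lsMeasure g a b)

/-- `K(t) = ∫_{1/2}^t J dg`, `0 < t < 1`. -/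
def KFun (P : Measure ℝ) (p ρ : ℝ) (lbar : ℝ → ℝ) (t : ℝ) : ℝ :=
  if 1 / 2 ≤ t then lsIntegral (JFun ρ lbar) (gFun P p) (1 / 2) t
  else -lsIntegral (JFun ρ lbar) (gFun P p) t (1 / 2)

/-- `σ(s,t)`, the non-negative square root of
`σ²(s,t) = ∫_s^t ∫_s^t (u ∧ v - u v) dK(u) dK(v)`, for `0 < s ≤ t < 1`. -/
def sigma (P : Measure ℝ) (p ρ : ℝ) (lbar : ℝ → ℝ) (s t : ℝ) : ℝ :=
  √(lsIntegral (fun v =>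
      lsIntegral (fun u => min u v - u * v) (KFun P p ρ lbar) s t) (KFun P p ρ lbar) s t)

/-- The centering sequence `μ_n = -n ∫_0^{k_n/n} J(u) g(u) du`. -/
def muSeq (P : Measure ℝ) (p ρ : ℝ) (lbar : ℝ → ℝ) (k : ℕ → ℕ) (n : ℕ) : ℝ :=
  -(n : ℝ) * ∫ u in (0 : ℝ)..((k n : ℝ) / n), JFun ρ lbar u * gFun P p u

/-- `α_n = k_n / (ρ + 1) * J(k_n/n) * (log (n/k_n))^p`. -/
def alphaSeq (p ρ : ℝ) (lbar : ℝ → ℝ) (k : ℕ → ℕ) (n : ℕ) : ℝ :=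
  (k n : ℝ) / (ρ + 1) * JFun ρ lbar ((k n : ℝ) / n) * Real.log ((n : ℝ) / k n) ^ p

/-- The condition on the integer sequence: `1 ≤ k_n < n`, `k_n → ∞`, `k_n / n → 0`. -/
structure KCond (k : ℕ → ℕ) : Prop where
  bounds : ∀ n : ℕ, 2 ≤ n → 1 ≤ k n ∧ k n < n
  tendsto_top : Tendsto k atTop atTop
  ratio : Tendsto (fun n : ℕ => (k n : ℝ) / n) atTop (𝓝 0)

/-- The weight function `L̄` is a non-negative continuous function on `(0,1)` that satisfies
Condition `L̄` with the constant `ρ` and the slowly varying function `ℓ̄`.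
(`L̄` generates the weights `d_{i,n} = n ∫_{(i-1)/n}^{i/n} L̄(t) dt`.) -/
structure LbarCond (Lbar : ℝ → ℝ) (ρ : ℝ) (lbar : ℝ → ℝ) : Prop where
  nonneg : ∀ t ∈ Ioo (0 : ℝ) 1, 0 ≤ Lbar t
  cont : ContinuousOn Lbar (Ioo 0 1)
  rho_gt : -(1 / 2) < ρ
  factor : ∀ t ∈ Ioo (0 : ℝ) 1, Lbar (1 - t) = t ^ ρ * lbar t
  slow : SlowlyVaryingAtZero lbar
  deriv : ∃ (δ : ℝ) (ε : ℝ → ℝ), 0 < δ ∧ δ ≤ 1 ∧ ContinuousOn ε (Ioo 0 δ) ∧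
    Tendsto ε (𝓝[>] 0) (𝓝 0) ∧
    ∀ t ∈ Ioo 0 δ, HasDerivAt lbar (t⁻¹ * lbar t * ε t) t
  unif : ∀ M : ℝ, 1 ≤ M → Tendsto (fun n : ℕ => ⨆ y ∈ Ioo (1 / M) M,
    ENNReal.ofReal |∫ u in (0 : ℝ)..y,
      (lbar (u / n) - lbar (y / n)) * u ^ ρ / (lbar (y / n) * y ^ ρ)|) atTop (𝓝 0)

end PowerSums

end

noncomputable section

namespace PowerSums

/-! ### The tail quantile function -/

/-! Write `q(t) = log Q(1-t-)` (`logTail`), so that `g = -q^p`. Since `1 - F` is regularly varying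
with index `-1/γ`, its generalized inverse is regularly varying at 0 with index `-γ`
(`MemR.tendsto_tailQuantile_ratio`). Hence `q(ct) - q(t) → -γ log c`; a Cesàro argument gives `q(t)
~ γ log(1/t)`, and a difference quotient of `r ↦ r^p` gives `g(t) - g(ct) ~ -p γ^p log c · (log
1/t)^(p-1)` (`MemR.tendsto_gFun_sub`). At scale `t`, `dg` thus looks like a multiple of `dz/z`, and,
with `D(t) = J(t) (log 1/t)^(p-1)`, `dK` looks like `p γ^p D(t) z^(ρ-1) dz`. Integration by parts,
which moves the differential onto the smooth function `J`, makes this precise (`tendsto_KFun_sub`).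

For the variance, Fubini with `min(u,v) = ∫ 1{w ≤ u} 1{w ≤ v} dw` yields `σ²(s,t) = ∫_0^t m² -
(∫_0^t m)²`, where `m(w) = K(t) - K(max s w)` (`sigma_eq`). For `s = 1/n`, `t = a = k_n/n`, the
substitution `w = x a` turns this into `a D(a)² (∫ N² - a (∫ N)²)`, with `N(x) → p γ^p ∫_x^1 z^(ρ-1)
dz`. Potter-type bounds dominate `N` by a multiple of `x^(-β)` with `β < 1/2`, possible exactly
because `ρ > -1/2`; the second term vanishes since `a → 0`, and `∫_0^1 (∫_x^1 z^(ρ-1) dz)² dx` is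
the stated constant (`tendsto_variance`).

The centering is a Karamata integral: after the same substitution, dominated convergence gives
`∫_0^1 x^ρ dx · γ^p` (`tendsto_integral_JFun_mul`). -/

/-- The left-continuous version of `t ↦ Q(1 - t)`. -/
def tailQuantile (P : Measure ℝ) (t : ℝ) : ℝ :=
  Function.leftLim (fun s => quantile P (1 - s)) t

/-- The logarithm of the tail quantile function. -/
def logTail (P : Measure ℝ) (t : ℝ) : ℝ := Real.log (tailQuantile P t)

theorem gFun_eq (P : Measure ℝ) (p t : ℝ) : gFun P p t = -(logTail P t) ^ p := rfl

theorem MemR.cdf_eq_zero {γ : ℝ} {P : Measure ℝ} (hF : MemR γ P) {x : ℝ} (hx : x < 1) :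
    cdf P x = 0 :=
  le_antisymm (hF.2 ▸ (monotone_cdf P).le_leftLim hx) (cdf_nonneg P x)

theorem MemR.tail_pos {γ : ℝ} {P : Measure ℝ} (hF : MemR γ P) (x : ℝ) : 0 < 1 - cdf P x := by
  obtain ⟨⟨L, ⟨A, hA, hpos, -, -⟩, hL⟩, -⟩ := hF
  have h1 := hL (max x A) (lt_max_of_lt_right hA)
  have h2 : 0 < 1 - cdf P (max x A) := by
    rw [h1]
    exact mul_pos (Real.rpow_pos_of_pos (lt_max_of_lt_right hA) _)
      (hpos _ (mem_Ici.2 (le_max_right _ _)))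
  have h3 := monotone_cdf P (le_max_left x A)
  linarith

/-- Regular variation of the tail. -/
theorem MemR.tendsto_tail_ratio {γ : ℝ} {P : Measure ℝ} (hF : MemR γ P) {c : ℝ} (hc : 0 < c) :
    Tendsto (fun x => (1 - cdf P (c * x)) / (1 - cdf P x)) atTop (𝓝 (c ^ (-(1 / γ)))) := by
  obtain ⟨⟨L, ⟨A, hA, hpos, -, hlim⟩, hL⟩, -⟩ := hF
  have h1 := (hlim c hc).const_mul (c ^ (-(1 / γ)))
  rw [mul_one] at h1
  refine h1.congr' ?_
  filter_upwards [eventually_gt_atTop 0, eventually_ge_atTop A] with x hx hxA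
  rw [hL x hx, hL (c * x) (mul_pos hc hx), Real.mul_rpow hc.le hx.le]
  have := (hpos x hxA).ne'
  have := (Real.rpow_pos_of_pos hx (-(1 / γ))).ne'
  field_simp

theorem quantileSet_bddBelow {P : Measure ℝ} (h0 : ∀ x < 1, cdf P x = 0)
    {s : ℝ} (hs : 0 < s) : BddBelow {x : ℝ | s ≤ cdf P x} :=
  ⟨1, fun x hx => by
    by_contra h
    have := h0 x (not_le.1 h)
    have : s ≤ cdf P x := hx
    linarith⟩

theorem quantileSet_nonempty {P : Measure ℝ} {s : ℝ} (hs : s < 1) : {x : ℝ | s ≤ cdf P x}.Nonempty :=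
  (((tendsto_order.1 (tendsto_cdf_atTop P)).1 s hs).mono fun _ h => le_of_lt h).exists

theorem quantile_le {P : Measure ℝ} (h0 : ∀ x < 1, cdf P x = 0)
    {s x : ℝ} (hs : 0 < s) (hx : s ≤ cdf P x) : quantile P s ≤ x :=
  csInf_le (quantileSet_bddBelow h0 hs) hx

theorem le_quantile {P : Measure ℝ} {s x : ℝ} (hs : s < 1) (hx : cdf P x < s) : x ≤ quantile P s :=
  le_csInf (quantileSet_nonempty hs) fun y hy => by
    by_contra h
    have h1 := monotone_cdf P (not_le.1 h).le
    have : s ≤ cdf P y := hy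
    linarith

theorem antitoneOn_quantile {P : Measure ℝ} (h0 : ∀ x < 1, cdf P x = 0)
    : AntitoneOn (fun s => quantile P (1 - s)) (Ioo 0 1) :=
  fun s hs t ht hst => csInf_le_csInf (quantileSet_bddBelow h0 (by linarith [ht.2]))
    (quantileSet_nonempty (by linarith [hs.1])) fun x hx => by
      have h1 : 1 - s ≤ cdf P x := hx
      exact le_trans (by linarith) h1

theorem one_le_quantile {P : Measure ℝ} (h0 : ∀ x < 1, cdf P x = 0)
    {s : ℝ} (hs : s ∈ Ioo (0 : ℝ) 1) : 1 ≤ quantile P s := by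
  refine le_csInf (quantileSet_nonempty hs.2) fun y hy => ?_
  by_contra h
  have := h0 y (not_le.1 h)
  have : s ≤ cdf P y := hy
  linarith [hs.1]

theorem tendsto_tailQuantile {P : Measure ℝ} (h0 : ∀ x < 1, cdf P x = 0)
    {t : ℝ} (ht : t ∈ Ioo (0 : ℝ) 1) :
    Tendsto (fun s => quantile P (1 - s)) (𝓝[<] t) (𝓝 (tailQuantile P t)) := by
  refine tendsto_leftLim_of_tendsto ⟨sInf ((fun s => quantile P (1 - s)) '' Ioo 0 t), ?_⟩
  have := AntitoneOn.tendsto_nhdsWithin_Ioo_left (f := fun s => quantile P (1 - s))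
    (y := 0) (x := t) ?_ ((antitoneOn_quantile h0).mono (Ioo_subset_Ioo_right ht.2.le)) ?_
  · exact this
  · exact nonempty_Ioo.2 ht.1
  · refine ⟨1, ?_⟩
    rintro _ ⟨s, hs, rfl⟩
    exact one_le_quantile h0 ⟨by linarith [hs.2, ht.2], by linarith [hs.1]⟩

/-- With `le_tailQuantile` this is the Galois-type pair from which the later facts on `tailQuantile`
are drawn. The left limit looks only at `s < t`: here strictness leaves room for `s` between the
tail and `t`, whereas in `le_tailQuantile` the inequality `s < t` itself supplies the strictness. -/
theorem tailQuantile_le {P : Measure ℝ} (h0 : ∀ x < 1, cdf P x = 0)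
    {t x : ℝ} (ht : t ∈ Ioo (0 : ℝ) 1) (hx : 1 - cdf P x < t) :
    tailQuantile P t ≤ x := by
  refine le_of_tendsto (tendsto_tailQuantile h0 ht) ?_
  have h : max 0 (1 - cdf P x) < t := max_lt ht.1 hx
  filter_upwards [Ioo_mem_nhdsLT h] with s hs
  have := (le_max_right 0 (1 - cdf P x)).trans_lt hs.1
  exact quantile_le h0 (by linarith [hs.2, ht.2]) (by linarith)

theorem le_tailQuantile {P : Measure ℝ} (h0 : ∀ x < 1, cdf P x = 0)
    {t x : ℝ} (ht : t ∈ Ioo (0 : ℝ) 1) (hx : t ≤ 1 - cdf P x) :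
    x ≤ tailQuantile P t := by
  refine ge_of_tendsto (tendsto_tailQuantile h0 ht) ?_
  filter_upwards [Ioo_mem_nhdsLT ht.1] with s hs
  exact le_quantile (by linarith [hs.1]) (by linarith [hs.2])

theorem one_le_tailQuantile {P : Measure ℝ} (h0 : ∀ x < 1, cdf P x = 0)
    {t : ℝ} (ht : t ∈ Ioo (0 : ℝ) 1) : 1 ≤ tailQuantile P t := by
  refine ge_of_tendsto (tendsto_tailQuantile h0 ht) ?_
  filter_upwards [Ioo_mem_nhdsLT ht.1] with s hs
  exact one_le_quantile h0 ⟨by linarith [hs.2, ht.2], by linarith [hs.1]⟩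

theorem tail_lt_of_tailQuantile_lt {P : Measure ℝ} (h0 : ∀ x < 1, cdf P x = 0)
    {t x : ℝ} (ht : t ∈ Ioo (0 : ℝ) 1)
    (hx : tailQuantile P t < x) : 1 - cdf P x < t := by
  by_contra h
  exact absurd (le_tailQuantile h0 ht (not_lt.1 h)) (not_le.2 hx)

theorem le_tail_of_lt_tailQuantile {P : Measure ℝ} (h0 : ∀ x < 1, cdf P x = 0)
    {t x : ℝ} (ht : t ∈ Ioo (0 : ℝ) 1)
    (hx : x < tailQuantile P t) : t ≤ 1 - cdf P x := by
  by_contra h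
  exact absurd (tailQuantile_le h0 ht (not_le.1 h)) (not_le.2 hx)

theorem antitoneOn_tailQuantile {P : Measure ℝ} (h0 : ∀ x < 1, cdf P x = 0)
    : AntitoneOn (tailQuantile P) (Ioo 0 1) := by
  intro s hs t ht hst
  refine le_of_forall_gt fun x hx => ?_
  have h1 := tail_lt_of_tailQuantile_lt h0 hs (left_lt_add_div_two.2 hx)
  exact (tailQuantile_le h0 ht (h1.trans_le hst)).trans_lt (add_div_two_lt_right.2 hx)

theorem tailQuantile_leftCont {P : Measure ℝ} (h0 : ∀ x < 1, cdf P x = 0)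
    {t : ℝ} (ht : t ∈ Ioo (0 : ℝ) 1) :
    ContinuousWithinAt (tailQuantile P) (Iio t) t := by
  refine tendsto_order.2 ⟨fun x hx => ?_, fun x hx => ?_⟩
  · filter_upwards [Ioo_mem_nhdsLT ht.1] with s hs
    exact hx.trans_le (antitoneOn_tailQuantile h0 ⟨hs.1, hs.2.trans ht.2⟩ ht hs.2.le)
  · have h1 := tail_lt_of_tailQuantile_lt h0 ht (left_lt_add_div_two.2 hx)
    filter_upwards [Ioo_mem_nhdsLT (max_lt ht.1 h1)] with s hs
    exact (tailQuantile_le h0 ⟨(le_max_left _ _).trans_lt hs.1, hs.2.trans ht.2⟩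
      ((le_max_right _ _).trans_lt hs.1)).trans_lt (add_div_two_lt_right.2 hx)

theorem logTail_nonneg {P : Measure ℝ} (h0 : ∀ x < 1, cdf P x = 0)
    {t : ℝ} (ht : t ∈ Ioo (0 : ℝ) 1) : 0 ≤ logTail P t :=
  Real.log_nonneg (one_le_tailQuantile h0 ht)

theorem antitoneOn_logTail {P : Measure ℝ} (h0 : ∀ x < 1, cdf P x = 0)
    : AntitoneOn (logTail P) (Ioo 0 1) := fun _ hs _ ht hst =>
  Real.log_le_log (zero_lt_one.trans_le (one_le_tailQuantile h0 ht))
    (antitoneOn_tailQuantile h0 hs ht hst)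

theorem monotoneOn_gFun {P : Measure ℝ} (h0 : ∀ x < 1, cdf P x = 0)
    {p : ℝ} (hp : 0 < p) : MonotoneOn (gFun P p) (Ioo 0 1) :=
  fun _ hs _ ht hst => neg_le_neg
    (Real.rpow_le_rpow (logTail_nonneg h0 ht) (antitoneOn_logTail h0 hs ht hst) hp.le)

theorem gFun_leftCont {P : Measure ℝ} (h0 : ∀ x < 1, cdf P x = 0)
    {p : ℝ} (hp : 0 < p) {t : ℝ} (ht : t ∈ Ioo (0 : ℝ) 1) :
    ContinuousWithinAt (gFun P p) (Iio t) t := by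
  have h1 : ContinuousWithinAt (logTail P) (Iio t) t :=
    (tailQuantile_leftCont h0 ht).log (zero_lt_one.trans_le (one_le_tailQuantile h0 ht)).ne'
  exact (h1.rpow_const (Or.inr hp.le)).neg

/-! ### Asymptotics of the tail quantile function at zero -/

theorem eventually_mem_Ioo_zero {a : ℝ} (ha : 0 < a) : ∀ᶠ t : ℝ in 𝓝[>] 0, t ∈ Ioo 0 a :=
  Ioo_mem_nhdsGT ha

theorem tendsto_mul_nhdsGT_zero {c : ℝ} (hc : 0 < c) :
    Tendsto (fun t => c * t) (𝓝[>] 0) (𝓝[>] 0) := by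
  refine tendsto_nhdsWithin_iff.2 ⟨?_, ?_⟩
  · have : Tendsto (fun t : ℝ => c * t) (𝓝 0) (𝓝 (c * 0)) := tendsto_id.const_mul c
    rw [mul_zero] at this
    exact this.mono_left nhdsWithin_le_nhds
  · filter_upwards [self_mem_nhdsWithin] with t ht
    exact mul_pos hc ht

theorem tendsto_neg_log_nhdsGT_zero : Tendsto (fun t => -Real.log t) (𝓝[>] 0) atTop :=
  tendsto_neg_atBot_atTop.comp Real.tendsto_log_nhdsGT_zero

theorem MemR.tendsto_tailQuantile_atTop {γ : ℝ} {P : Measure ℝ} (hF : MemR γ P) :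
    Tendsto (tailQuantile P) (𝓝[>] 0) atTop := by
  refine tendsto_atTop.2 fun x => ?_
  filter_upwards [eventually_mem_Ioo_zero (lt_min one_pos (hF.tail_pos x))] with t ht
  exact le_tailQuantile (fun _ => hF.cdf_eq_zero) ⟨ht.1, ht.2.trans_le (min_le_left _ _)⟩
    (ht.2.le.trans (min_le_right _ _))

/-- Inversion of regular variation: comparing the tail at `b' Q` with `c t`, where `Q` is the tail
quantile at `t`, decides on which side of `b' Q` the quantile at `c t` lies. -/
theorem MemR.tendsto_tailQuantile_ratio {γ : ℝ} {P : Measure ℝ} (hF : MemR γ P) (hγ : 0 < γ)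
    {c : ℝ} (hc : 0 < c) (hc1 : c < 1) :
    Tendsto (fun t => tailQuantile P (c * t) / tailQuantile P t) (𝓝[>] 0) (𝓝 (c ^ (-γ))) := by
  have h0 : ∀ x < 1, cdf P x = 0 := fun _ => hF.cdf_eq_zero
  have hcγ : 0 < c ^ (-γ) := Real.rpow_pos_of_pos hc _
  have hinv : (c ^ (-γ)) ^ (-(1 / γ)) = c := by
    rw [← Real.rpow_mul hc.le, neg_mul_neg, mul_one_div_cancel hγ.ne', Real.rpow_one]
  have hneg : -(1 / γ) < 0 := by have := one_div_pos.2 hγ; linarith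
  refine tendsto_order.2 ⟨fun b hb => ?_, fun b hb => ?_⟩
  · rcases le_or_gt b 0 with hb0 | hb0
    · filter_upwards [eventually_mem_Ioo_zero one_pos] with t ht
      have h1 := one_le_tailQuantile h0 ht
      have h2 := one_le_tailQuantile h0 (t := c * t)
        ⟨mul_pos hc ht.1, by nlinarith [ht.1, ht.2]⟩
      exact hb0.trans_lt (by positivity)
    obtain ⟨b', hb1, hb2⟩ := exists_between hb
    -- The tail at the quantile itself need not be close to `t`, since `F` may jump. The factor `b'
    -- / l < 1` moves strictly below the quantile, where the tail is at least `t`; scaling by `l`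
    -- then lands on `b'` times the quantile.
    obtain ⟨l, hl1, hl2⟩ := exists_between hb2
    have hb' : 0 < b' := hb0.trans hb1
    have hl : 0 < l := hb'.trans hl1
    have hlc : c < l ^ (-(1 / γ)) := by
      rw [← hinv]; exact Real.rpow_lt_rpow_of_neg hl hl2 hneg
    have hev := ((hF.tendsto_tailQuantile_atTop.const_mul_atTop (div_pos hb' hl)).eventually
      ((tendsto_order.1 (hF.tendsto_tail_ratio hl)).1 c hlc))
    filter_upwards [eventually_mem_Ioo_zero one_pos, hev] with t ht hev
    have hV := one_le_tailQuantile h0 ht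
    have h1 : b' / l * tailQuantile P t < tailQuantile P t := by
      have : b' / l < 1 := (div_lt_one hl).2 hl1
      nlinarith
    have h2 := le_tail_of_lt_tailQuantile h0 ht h1
    rw [lt_div_iff₀ (hF.tail_pos _)] at hev
    have h3 : l * (b' / l * tailQuantile P t) = b' * tailQuantile P t := by field_simp
    rw [h3] at hev
    have h4 : c * t ≤ 1 - cdf P (b' * tailQuantile P t) :=
      (mul_le_mul_of_nonneg_left h2 hc.le).trans hev.le
    have h5 := le_tailQuantile h0 ⟨mul_pos hc ht.1, by nlinarith [ht.1, ht.2]⟩ h4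
    exact hb1.trans_le ((le_div_iff₀ (by linarith)).2 h5)
  · obtain ⟨b', hb2, hb1⟩ := exists_between hb
    obtain ⟨l, hl2, hl1⟩ := exists_between hb2
    have hl : 0 < l := hcγ.trans hl2
    have hb' : 0 < b' := hl.trans hl1
    have hlc : l ^ (-(1 / γ)) < c := by
      conv_rhs => rw [← hinv]
      exact Real.rpow_lt_rpow_of_neg hcγ hl2 hneg
    have hev := ((hF.tendsto_tailQuantile_atTop.const_mul_atTop (div_pos hb' hl)).eventually
      ((tendsto_order.1 (hF.tendsto_tail_ratio hl)).2 c hlc))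
    filter_upwards [eventually_mem_Ioo_zero one_pos, hev] with t ht hev
    have hV := one_le_tailQuantile h0 ht
    have h1 : tailQuantile P t < b' / l * tailQuantile P t := by
      have : 1 < b' / l := (one_lt_div hl).2 hl1
      nlinarith
    have h2 := tail_lt_of_tailQuantile_lt h0 ht h1
    rw [div_lt_iff₀ (hF.tail_pos _)] at hev
    have h3 : l * (b' / l * tailQuantile P t) = b' * tailQuantile P t := by field_simp
    rw [h3] at hev
    have h4 : 1 - cdf P (b' * tailQuantile P t) < c * t :=
      hev.trans (mul_lt_mul_of_pos_left h2 hc)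
    have h5 := tailQuantile_le h0 ⟨mul_pos hc ht.1, by nlinarith [ht.1, ht.2]⟩ h4
    exact ((div_le_iff₀ (by linarith)).2 h5).trans_lt hb1

theorem MemR.tendsto_logTail_sub {γ : ℝ} {P : Measure ℝ} (hF : MemR γ P) (hγ : 0 < γ)
    {c : ℝ} (hc : 0 < c) (hc1 : c < 1) :
    Tendsto (fun t => logTail P (c * t) - logTail P t) (𝓝[>] 0) (𝓝 (γ * -Real.log c)) := by
  have h1 := (hF.tendsto_tailQuantile_ratio hγ hc hc1).log (Real.rpow_pos_of_pos hc _).ne'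
  rw [Real.log_rpow hc, neg_mul, ← mul_neg] at h1
  refine h1.congr' ?_
  filter_upwards [eventually_mem_Ioo_zero one_pos] with t ht
  have h0 : ∀ x < 1, cdf P x = 0 := fun _ => hF.cdf_eq_zero
  have h2 := one_le_tailQuantile h0 ht
  have h3 := one_le_tailQuantile h0 (t := c * t) ⟨mul_pos hc ht.1, by nlinarith [ht.1, ht.2]⟩
  exact Real.log_div (by linarith) (by linarith)

/-- An antitone function whose increments over geometric steps converge is asymptotically a
multiple of the logarithm. -/
theorem tendsto_div_neg_log_of_tendsto_sub {q : ℝ → ℝ} {γ : ℝ} (hq : AntitoneOn q (Ioo 0 1))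
    (hq0 : ∀ t ∈ Ioo (0 : ℝ) 1, 0 ≤ q t)
    (h : Tendsto (fun t => q (Real.exp (-1) * t) - q t) (𝓝[>] 0) (𝓝 γ)) :
    Tendsto (fun t => q t / -Real.log t) (𝓝[>] 0) (𝓝 γ) := by
  -- The shift by one keeps every sample point, including that for `n = 0`, inside the open interval
  -- `(0, 1)`.
  set G : ℕ → ℝ := fun n => q (Real.exp (-((n : ℝ) + 1))) with hG
  have hexp : Tendsto (fun n : ℕ => Real.exp (-((n : ℝ) + 1))) atTop (𝓝[>] 0) := by
    refine tendsto_nhdsWithin_iff.2 ⟨?_, Eventually.of_forall fun n => Real.exp_pos _⟩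
    exact Real.tendsto_exp_neg_atTop_nhds_zero.comp
      (tendsto_atTop_add_const_right _ _ tendsto_natCast_atTop_atTop)
  have h1 : Tendsto (fun n => G (n + 1) - G n) atTop (𝓝 γ) := by
    refine (h.comp hexp).congr fun n => ?_
    simp only [Function.comp_apply, hG, ← Real.exp_add]
    push_cast
    ring_nf
  have h2 : Tendsto (fun n : ℕ => G n / n) atTop (𝓝 γ) := by
    have h3 := h1.cesaro
    have h4 : Tendsto (fun n : ℕ => G 0 / (n : ℝ)) atTop (𝓝 0) :=
      tendsto_const_div_atTop_nhds_zero_nat _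
    have h5 := h3.add h4
    rw [add_zero] at h5
    refine h5.congr fun n => ?_
    rw [Finset.sum_range_sub]
    ring
  have hfl : Tendsto (fun t : ℝ => ⌊-Real.log t⌋₊) (𝓝[>] 0) atTop :=
    tendsto_nat_floor_atTop.comp tendsto_neg_log_nhdsGT_zero
  have hlow : Tendsto (fun m : ℕ => G (m - 1) / ((m : ℝ) + 1)) atTop (𝓝 γ) := by
    rw [← tendsto_add_atTop_iff_nat 1]
    have h3 : Tendsto (fun m : ℕ => (m : ℝ) / ((m : ℝ) + 2)) atTop (𝓝 1) :=
      tendsto_natCast_div_add_atTop 2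
    have h4 := h2.mul h3
    rw [mul_one] at h4
    refine h4.congr' ?_
    filter_upwards [eventually_gt_atTop 0] with m hm
    have : (m : ℝ) ≠ 0 := by positivity
    simp only [Nat.add_sub_cancel]
    push_cast
    field_simp
    ring
  -- With `m = ⌊-log t⌋` one has `e^(-(m+1)) ≤ t ≤ e^(-m)`, so `G (m - 1) ≤ q t ≤ G m` while `m ≤
  -- -log t ≤ m + 1`.
  refine tendsto_of_tendsto_of_tendsto_of_le_of_le' (hlow.comp hfl) (h2.comp hfl) ?_ ?_
  · filter_upwards [eventually_mem_Ioo_zero one_pos,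
      tendsto_neg_log_nhdsGT_zero.eventually_ge_atTop 1] with t ht ht1
    have hm1 : 1 ≤ ⌊-Real.log t⌋₊ := (Nat.one_le_floor_iff _).2 ht1
    have hm := Nat.floor_le (zero_le_one.trans ht1)
    have hm' := Nat.lt_floor_add_one (-Real.log t)
    simp only [Function.comp_apply]
    generalize ⌊-Real.log t⌋₊ = m at hm1 hm hm'
    have h3 : ((m - 1 : ℕ) : ℝ) + 1 = m := by rw [Nat.cast_sub hm1]; simp
    have h4 : t ≤ Real.exp (-(m : ℝ)) := by
      rw [← Real.log_le_iff_le_exp ht.1]; linarith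
    have hm1' : (1 : ℝ) ≤ m := by exact_mod_cast hm1
    have h5 : G (m - 1) ≤ q t := by
      simp only [hG, h3]
      exact hq ht ⟨Real.exp_pos _, Real.exp_lt_one_iff.2 (by linarith)⟩ h4
    exact div_le_div₀ (hq0 t ht) h5 (by linarith) hm'.le
  · filter_upwards [eventually_mem_Ioo_zero one_pos,
      tendsto_neg_log_nhdsGT_zero.eventually_ge_atTop 1] with t ht ht1
    have hm1 : 1 ≤ ⌊-Real.log t⌋₊ := (Nat.one_le_floor_iff _).2 ht1
    have hm := Nat.floor_le (zero_le_one.trans ht1)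
    have hm' := Nat.lt_floor_add_one (-Real.log t)
    simp only [Function.comp_apply]
    generalize ⌊-Real.log t⌋₊ = m at hm1 hm hm'
    have h4 : Real.exp (-((m : ℝ) + 1)) ≤ t := by
      rw [← Real.le_log_iff_exp_le ht.1]; linarith
    have hm1' : (1 : ℝ) ≤ m := by exact_mod_cast hm1
    have hmem : Real.exp (-((m : ℝ) + 1)) ∈ Ioo (0 : ℝ) 1 :=
      ⟨Real.exp_pos _, Real.exp_lt_one_iff.2 (by linarith)⟩
    exact div_le_div₀ (hq0 _ hmem) (hq hmem ht h4) (by linarith) hm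

theorem MemR.tendsto_logTail_div {γ : ℝ} {P : Measure ℝ} (hF : MemR γ P) (hγ : 0 < γ) :
    Tendsto (fun t => logTail P t / -Real.log t) (𝓝[>] 0) (𝓝 γ) := by
  have h0 : ∀ x < 1, cdf P x = 0 := fun _ => hF.cdf_eq_zero
  refine tendsto_div_neg_log_of_tendsto_sub (antitoneOn_logTail h0)
    (fun t ht => logTail_nonneg h0 ht) ?_
  have h1 := hF.tendsto_logTail_sub hγ (Real.exp_pos (-1)) (Real.exp_lt_one_iff.2 (by norm_num))
  simpa using h1

theorem MemR.tendsto_logTail_atTop {γ : ℝ} {P : Measure ℝ} (hF : MemR γ P) :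
    Tendsto (logTail P) (𝓝[>] 0) atTop :=
  Real.tendsto_log_atTop.comp hF.tendsto_tailQuantile_atTop

/-- The ratio of `logTail` at proportional points. -/
theorem MemR.tendsto_logTail_ratio {γ : ℝ} {P : Measure ℝ} (hF : MemR γ P) (hγ : 0 < γ)
    {c : ℝ} (hc : 0 < c) (hc1 : c ≤ 1) :
    Tendsto (fun t => logTail P (c * t) / logTail P t) (𝓝[>] 0) (𝓝 1) := by
  rcases hc1.eq_or_lt with rfl | hc1
  · refine tendsto_const_nhds.congr' ?_
    filter_upwards [hF.tendsto_logTail_atTop.eventually_gt_atTop 0] with t ht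
    rw [one_mul, div_self ht.ne']
  · have h1 := ((hF.tendsto_logTail_sub hγ hc hc1).div_atTop hF.tendsto_logTail_atTop).const_add 1
    rw [add_zero] at h1
    refine h1.congr' ?_
    filter_upwards [hF.tendsto_logTail_atTop.eventually_gt_atTop 0] with t ht
    field_simp
    ring

/-- Increments of `g` over geometric steps. -/
theorem MemR.tendsto_gFun_sub {γ p : ℝ} {P : Measure ℝ} (hF : MemR γ P) (hγ : 0 < γ)
    {c : ℝ} (hc : 0 < c) (hc1 : c ≤ 1) :
    Tendsto (fun t => (gFun P p t - gFun P p (c * t)) / (-Real.log t) ^ (p - 1)) (𝓝[>] 0)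
      (𝓝 (p * γ ^ p * -Real.log c)) := by
  rcases hc1.eq_or_lt with rfl | hc1
  · simp
  have h0 : ∀ x < 1, cdf P x = 0 := fun _ => hF.cdf_eq_zero
  have hd : HasDerivAt (fun r : ℝ => r ^ p) p 1 := by
    simpa using Real.hasDerivAt_rpow_const (x := 1) (p := p) (Or.inl one_ne_zero)
  -- `dslope` takes the value of the derivative at the base point, so no case split is needed where
  -- `logTail` has equal values at `c t` and `t`.
  have hcont := continuousAt_dslope_same.2 hd.differentiableAt
  have h1 : Tendsto (fun t => dslope (fun r : ℝ => r ^ p) 1 (logTail P (c * t) / logTail P t))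
      (𝓝[>] 0) (𝓝 p) := by
    have := hcont.tendsto.comp (hF.tendsto_logTail_ratio hγ hc hc1.le)
    rwa [dslope_same, hd.deriv] at this
  have h2 : Tendsto (fun t => (logTail P t / -Real.log t) ^ (p - 1)) (𝓝[>] 0)
      (𝓝 (γ ^ (p - 1))) := (hF.tendsto_logTail_div hγ).rpow_const (Or.inl hγ.ne')
  have h3 := (h1.mul h2).mul (hF.tendsto_logTail_sub hγ hc hc1)
  have e : p * γ ^ (p - 1) * (γ * -Real.log c) = p * γ ^ p * -Real.log c := by
    rw [Real.rpow_sub_one hγ.ne']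
    field_simp
  rw [e] at h3
  refine h3.congr' ?_
  filter_upwards [hF.tendsto_logTail_atTop.eventually_gt_atTop 0,
    tendsto_neg_log_nhdsGT_zero.eventually_gt_atTop 0, eventually_mem_Ioo_zero one_pos]
    with t hq hl ht
  have hq' : 0 ≤ logTail P (c * t) :=
    logTail_nonneg h0 ⟨mul_pos hc ht.1, by nlinarith [ht.1, ht.2]⟩
  have h4 := sub_smul_dslope (fun r : ℝ => r ^ p) 1 (logTail P (c * t) / logTail P t)
  simp only [smul_eq_mul, Real.one_rpow] at h4
  have hp1 : 0 < logTail P t ^ p := Real.rpow_pos_of_pos hq _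
  rw [Real.div_rpow hq.le hl.le, gFun_eq, gFun_eq, Real.rpow_sub_one hq.ne']
  rw [Real.div_rpow hq' hq.le] at h4
  have h5 : logTail P (c * t) ^ p - logTail P t ^ p = logTail P t ^ p *
      ((logTail P (c * t) / logTail P t - 1) *
        dslope (fun r : ℝ => r ^ p) 1 (logTail P (c * t) / logTail P t)) := by
    rw [h4]; field_simp
  rw [neg_sub_neg, h5]
  have := Real.rpow_pos_of_pos hl (p - 1)
  generalize dslope (fun r : ℝ => r ^ p) 1 (logTail P (c * t) / logTail P t) = D
  field_simp

/-! ### Potter bounds -/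

/-- A Potter-type bound for the increments of an antitone function whose increments over dyadic
steps are controlled by a function that varies slowly along dyadic steps. -/
theorem exists_increment_bound {f l : ℝ → ℝ} (hf : AntitoneOn f (Ioo 0 1))
    (hpos : ∀ᶠ t in 𝓝[>] 0, 0 < l t) {C : ℝ} (hC : 0 ≤ C)
    (h1 : ∀ᶠ t in 𝓝[>] 0, f (1 / 2 * t) - f t ≤ C * l t)
    (h2 : Tendsto (fun t => l (1 / 2 * t) / l t) (𝓝[>] 0) (𝓝 1)) {η : ℝ} (hη : 0 < η) :
    ∃ B, 0 < B ∧ ∃ t₀ ∈ Ioo (0 : ℝ) 1, ∀ t ∈ Ioo 0 t₀, ∀ x ∈ Ioc (0 : ℝ) 1,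
      f (x * t) - f t ≤ B * x ^ (-η) * l t := by
  set r : ℝ := 2 ^ η with hr
  have hr1 : 1 < r := Real.one_lt_rpow one_lt_two hη
  have hev : ∀ᶠ t in 𝓝[>] 0, 0 < l t ∧ f (1 / 2 * t) - f t ≤ C * l t ∧
      l (1 / 2 * t) ≤ (1 + r) / 2 * l t := by
    filter_upwards [hpos, h1, (tendsto_order.1 h2).2 ((1 + r) / 2) (by linarith)] with t a b c
    exact ⟨a, b, ((div_lt_iff₀ a).1 c).le⟩
  obtain ⟨t₁, ht₁, hsub⟩ := mem_nhdsGT_iff_exists_Ioo_subset.1 hev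
  have ht₁0 : 0 < t₁ := ht₁
  -- Near 0 each halving multiplies `l` by at most `(1 + r) / 2 < r`. The slack `B (r - 1) / 2 = C +
  -- 1` then absorbs the new increment `C` at every step of the induction.
  set B : ℝ := (C + 1) / ((r - 1) / 2) with hB
  have hr2 : 0 < (r - 1) / 2 := by linarith
  have hB0 : 0 < B := by positivity
  have hind : ∀ j : ℕ, ∀ t ∈ Ioo 0 t₁, f ((1 / 2) ^ j * t) - f t ≤ B * r ^ j * l t := by
    intro j
    induction j with
    | zero =>
      intro t ht
      have := (hsub ht).1
      simp only [pow_zero, one_mul, sub_self, mul_one]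
      positivity
    | succ j ih =>
      intro t ht
      obtain ⟨ha, hb, hc⟩ := hsub ht
      have h3 := ih (1 / 2 * t) ⟨by linarith [ht.1], by linarith [ht.1, ht.2]⟩
      have h4 : (1 / 2 : ℝ) ^ (j + 1) * t = (1 / 2) ^ j * (1 / 2 * t) := by ring
      have hrj : 1 ≤ r ^ j := one_le_pow₀ hr1.le
      have h5 : B * r ^ j * l (1 / 2 * t) ≤ B * r ^ j * ((1 + r) / 2 * l t) :=
        mul_le_mul_of_nonneg_left hc (by positivity)
      have h6 : C ≤ B * r ^ j * ((r - 1) / 2) := by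
        have : B * ((r - 1) / 2) = C + 1 := by rw [hB, div_mul_cancel₀ _ hr2.ne']
        calc C ≤ (C + 1) * 1 := by linarith
          _ ≤ (C + 1) * r ^ j := mul_le_mul_of_nonneg_left hrj (by linarith)
          _ = B * r ^ j * ((r - 1) / 2) := by rw [← this]; ring
      have h7 := mul_le_mul_of_nonneg_right h6 ha.le
      rw [h4]
      calc f ((1 / 2) ^ j * (1 / 2 * t)) - f t
          ≤ B * r ^ j * ((1 + r) / 2 * l t) + B * r ^ j * ((r - 1) / 2) * l t := by linarith
        _ = B * r ^ (j + 1) * l t := by ring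
  refine ⟨B * r, by positivity, min t₁ (1 / 2), ⟨by positivity, by
    exact (min_le_right _ _).trans_lt (by norm_num)⟩, fun t ht x hx => ?_⟩
  have ht1 : t < t₁ := ht.2.trans_le (min_le_left _ _)
  have ht2 : t < 1 / 2 := ht.2.trans_le (min_le_right _ _)
  -- Here `2^(-(j+1)) < x ≤ 2^(-j)`; rounding `x` down to a power of two costs the extra factor `r`
  -- in the constant.
  obtain ⟨j, hj1, hj2⟩ := exists_nat_pow_near_of_lt_one hx.1 hx.2 (y := (1 / 2 : ℝ))
    (by norm_num) (by norm_num)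
  have h3 := hind (j + 1) t ⟨ht.1, ht1⟩
  have hp : (0 : ℝ) < (1 / 2) ^ (j + 1) := by positivity
  have h4 : f (x * t) ≤ f ((1 / 2) ^ (j + 1) * t) := by
    refine hf ⟨mul_pos hp ht.1, ?_⟩ ⟨mul_pos hx.1 ht.1, ?_⟩
      (mul_le_mul_of_nonneg_right hj1.le ht.1.le)
    · have := mul_le_mul_of_nonneg_right (hj1.le.trans hx.2) ht.1.le
      linarith
    · have := mul_le_mul_of_nonneg_right hx.2 ht.1.le
      linarith
  have h5 : r ^ j ≤ x ^ (-η) := by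
    calc r ^ j = ((1 / 2 : ℝ) ^ j) ^ (-η) := by
          rw [hr, ← Real.rpow_natCast, ← Real.rpow_natCast, ← Real.rpow_mul (by norm_num),
            ← Real.rpow_mul (by norm_num), one_div, Real.inv_rpow (by norm_num),
            ← Real.rpow_neg (by norm_num)]
          ring_nf
      _ ≤ x ^ (-η) := Real.rpow_le_rpow_of_nonpos hx.1 hj2 (by linarith)
  have hl := (hsub ⟨ht.1, ht1⟩).1
  calc f (x * t) - f t ≤ B * r ^ (j + 1) * l t := by linarith
    _ = B * r * r ^ j * l t := by ring
    _ ≤ B * r * x ^ (-η) * l t := by gcongr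

theorem tendsto_log_ratio {c : ℝ} (hc : 0 < c) :
    Tendsto (fun t => -Real.log (c * t) / -Real.log t) (𝓝[>] 0) (𝓝 1) := by
  have h1 := ((tendsto_const_nhds (x := -Real.log c)).div_atTop
    tendsto_neg_log_nhdsGT_zero).const_add 1
  rw [add_zero] at h1
  refine h1.congr' ?_
  filter_upwards [tendsto_neg_log_nhdsGT_zero.eventually_gt_atTop 0, self_mem_nhdsWithin]
    with t ht ht0
  rw [Real.log_mul hc.ne' (ne_of_gt ht0)]
  have : Real.log t ≠ 0 := by intro h; rw [h] at ht; simp at ht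
  field_simp
  ring

theorem tendsto_log_rpow_ratio (a : ℝ) {c : ℝ} (hc : 0 < c) :
    Tendsto (fun t => (-Real.log (c * t)) ^ a / (-Real.log t) ^ a) (𝓝[>] 0) (𝓝 1) := by
  have h1 := (tendsto_log_ratio hc).rpow_const (p := a) (Or.inl one_ne_zero)
  rw [Real.one_rpow] at h1
  refine h1.congr' ?_
  filter_upwards [tendsto_neg_log_nhdsGT_zero.eventually_gt_atTop 0,
    (tendsto_neg_log_nhdsGT_zero.comp (tendsto_mul_nhdsGT_zero hc)).eventually_gt_atTop 0]
    with t h1 h2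
  exact Real.div_rpow (le_of_lt h2) h1.le _

/-- The increment bound for `-g`: its dyadic increments converge after division by `(-log t)^(p-1)`,
which is slowly varying. -/
theorem MemR.exists_gFun_sub_bound {γ p : ℝ} {P : Measure ℝ} (hF : MemR γ P) (hγ : 0 < γ)
    (hp : 0 < p) {η : ℝ} (hη : 0 < η) :
    ∃ B, 0 < B ∧ ∃ t₀ ∈ Ioo (0 : ℝ) 1, ∀ t ∈ Ioo 0 t₀, ∀ x ∈ Ioc (0 : ℝ) 1,
      gFun P p t - gFun P p (x * t) ≤ B * x ^ (-η) * (-Real.log t) ^ (p - 1) := by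
  have hpos : ∀ᶠ t in 𝓝[>] 0, 0 < (-Real.log t) ^ (p - 1) := by
    filter_upwards [tendsto_neg_log_nhdsGT_zero.eventually_gt_atTop 0] with t ht
    exact Real.rpow_pos_of_pos ht _
  have hC : 0 < p * γ ^ p * -Real.log (1 / 2) := by
    have : Real.log (1 / 2) < 0 := Real.log_neg (by norm_num) (by norm_num)
    have := Real.rpow_pos_of_pos hγ p
    exact mul_pos (by positivity) (by linarith)
  have hstep : ∀ᶠ t in 𝓝[>] 0, -gFun P p (1 / 2 * t) - -gFun P p t ≤
      (p * γ ^ p * -Real.log (1 / 2) + 1) * (-Real.log t) ^ (p - 1) := by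
    filter_upwards [hpos, (tendsto_order.1 (hF.tendsto_gFun_sub (p := p) hγ (c := 1 / 2)
      (by norm_num) (by norm_num))).2 (p * γ ^ p * -Real.log (1 / 2) + 1) (by linarith)]
      with t h1 h2
    rw [div_lt_iff₀ h1] at h2
    linarith
  obtain ⟨B, hB, t₀, ht₀, h⟩ := exists_increment_bound (f := fun t => -gFun P p t)
    (l := fun t => (-Real.log t) ^ (p - 1)) (C := p * γ ^ p * -Real.log (1 / 2) + 1)
    (fun s hs t ht hst => neg_le_neg (monotoneOn_gFun (fun _ => hF.cdf_eq_zero) hp hs ht hst))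
    hpos (by linarith) hstep (tendsto_log_rpow_ratio _ (by norm_num)) hη
  exact ⟨B, hB, t₀, ht₀, fun t ht x hx => by have := h t ht x hx; linarith⟩

theorem MemR.exists_logTail_rpow_bound {γ p : ℝ} {P : Measure ℝ} (hF : MemR γ P) (hγ : 0 < γ)
    (hp : 0 < p) {η : ℝ} (hη : 0 < η) :
    ∃ B, 0 < B ∧ ∃ t₀ ∈ Ioo (0 : ℝ) 1, ∀ t ∈ Ioo 0 t₀, ∀ x ∈ Ioc (0 : ℝ) 1,
      logTail P (x * t) ^ p ≤ B * x ^ (-η) * logTail P t ^ p := by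
  have h0 : ∀ x < 1, cdf P x = 0 := fun _ => hF.cdf_eq_zero
  have hpos : ∀ᶠ t in 𝓝[>] 0, 0 < logTail P t ^ p := by
    filter_upwards [hF.tendsto_logTail_atTop.eventually_gt_atTop 0] with t ht
    exact Real.rpow_pos_of_pos ht _
  have hrat : Tendsto (fun t => logTail P (1 / 2 * t) ^ p / logTail P t ^ p) (𝓝[>] 0) (𝓝 1) := by
    have h1 := (hF.tendsto_logTail_ratio hγ (c := 1 / 2) (by norm_num)
      (by norm_num)).rpow_const (p := p) (Or.inl one_ne_zero)
    rw [Real.one_rpow] at h1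
    refine h1.congr' ?_
    filter_upwards [eventually_mem_Ioo_zero one_pos] with t ht
    exact Real.div_rpow (logTail_nonneg h0 ⟨by linarith [ht.1], by linarith [ht.1, ht.2]⟩)
      (logTail_nonneg h0 ht) _
  have hstep : ∀ᶠ t in 𝓝[>] 0, logTail P (1 / 2 * t) ^ p - logTail P t ^ p ≤
      1 * logTail P t ^ p := by
    filter_upwards [hpos, (tendsto_order.1 hrat).2 2 (by norm_num)] with t h1 h2
    rw [div_lt_iff₀ h1] at h2
    linarith
  obtain ⟨B, hB, t₀, ht₀, h⟩ := exists_increment_bound (f := fun t => logTail P t ^ p)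
    (l := fun t => logTail P t ^ p) (C := 1)
    (fun s hs t ht hst => Real.rpow_le_rpow (logTail_nonneg h0 ht)
      (antitoneOn_logTail h0 hs ht hst) hp.le) hpos zero_le_one hstep hrat hη
  -- The subtracted term `logTail P t ^ p` is absorbed because `x ^ (-η) ≥ 1`.
  refine ⟨B + 1, by linarith, t₀, ht₀, fun t ht x hx => ?_⟩
  have h1 := h t ht x hx
  have h2 : 1 ≤ x ^ (-η) := Real.one_le_rpow_of_pos_of_le_one_of_nonpos hx.1 hx.2 (by linarith)
  have h3 : 0 ≤ logTail P t ^ p :=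
    Real.rpow_nonneg (logTail_nonneg h0 ⟨ht.1, ht.2.trans ht₀.2⟩) _
  nlinarith [mul_le_mul_of_nonneg_right h2 h3]

/-- The derivative condition makes `t^η ℓ̄(t)` non-decreasing near 0: its logarithmic derivative is
`(η + ε(t)) / t > 0`. This gives a Potter bound with constant 1. -/
theorem LbarCond.lbar_potter {Lbar lbar : ℝ → ℝ} {ρ : ℝ} (hL : LbarCond Lbar ρ lbar) {η : ℝ}
    (hη : 0 < η) :
    ∃ t₀ ∈ Ioo (0 : ℝ) 1, ∀ t ∈ Ioo 0 t₀, 0 < lbar t ∧ ∀ x ∈ Ioc (0 : ℝ) 1,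
      lbar (x * t) ≤ x ^ (-η) * lbar t := by
  obtain ⟨δ, ε, hδ, hδ1, -, hε, hd⟩ := hL.deriv
  obtain ⟨δ', hδ', hpos, -, -⟩ := hL.slow
  obtain ⟨t₁, ht₁, hsub⟩ := mem_nhdsGT_iff_exists_Ioo_subset.1
    ((tendsto_order.1 hε).1 (-η) (by linarith))
  have ht₁0 : 0 < t₁ := ht₁
  set t₀ := min (min δ δ') (min t₁ (1 / 2)) with ht₀
  have hm : MonotoneOn (fun t => t ^ η * lbar t) (Ioo 0 t₀) := by
    have hder : ∀ t ∈ Ioo 0 t₀, HasDerivAt (fun t => t ^ η * lbar t)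
        (η * t ^ (η - 1) * lbar t + t ^ η * (t⁻¹ * lbar t * ε t)) t := fun t ht =>
      (Real.hasDerivAt_rpow_const (Or.inl ht.1.ne')).mul
        (hd t ⟨ht.1, ht.2.trans_le ((min_le_left _ _).trans (min_le_left _ _))⟩)
    refine monotoneOn_of_deriv_nonneg (convex_Ioo _ _)
      (fun t ht => (hder t ht).continuousAt.continuousWithinAt) ?_ ?_
    · rw [interior_Ioo]
      exact fun t ht => (hder t ht).differentiableAt.differentiableWithinAt
    · rw [interior_Ioo]
      intro t ht
      rw [(hder t ht).deriv, Real.rpow_sub_one ht.1.ne']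
      have h1 : -η < ε t := hsub ⟨ht.1, ht.2.trans_le ((min_le_right _ _).trans (min_le_left _ _))⟩
      have h2 := hpos t ⟨ht.1, ht.2.trans_le ((min_le_left _ _).trans (min_le_right _ _))⟩
      have h3 := Real.rpow_pos_of_pos ht.1 η
      have h4 := ht.1
      have h5 : η * (t ^ η / t) * lbar t + t ^ η * (t⁻¹ * lbar t * ε t) =
        t ^ η / t * lbar t * (η + ε t) := by field_simp
      rw [h5]
      have : 0 < η + ε t := by linarith
      positivity
  refine ⟨t₀, ⟨by positivity, ?_⟩, fun t ht => ⟨?_, fun x hx => ?_⟩⟩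
  · exact ((min_le_right _ _).trans (min_le_right _ _)).trans_lt (by norm_num)
  · exact hpos t ⟨ht.1, ht.2.trans_le ((min_le_left _ _).trans (min_le_right _ _))⟩
  · have hxt : x * t ≤ t := by nlinarith [hx.1, hx.2, ht.1]
    have h1 := hm ⟨mul_pos hx.1 ht.1, hxt.trans_lt ht.2⟩ ht hxt
    simp only [Real.mul_rpow hx.1.le ht.1.le] at h1
    have h2 := Real.rpow_pos_of_pos hx.1 η
    have h3 := Real.rpow_pos_of_pos ht.1 η
    rw [Real.rpow_neg hx.1.le, ← div_eq_inv_mul, le_div_iff₀ h2]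
    nlinarith

theorem LbarCond.JFun_potter {Lbar lbar : ℝ → ℝ} {ρ : ℝ} (hL : LbarCond Lbar ρ lbar) {η : ℝ}
    (hη : 0 < η) :
    ∃ t₀ ∈ Ioo (0 : ℝ) 1, ∀ t ∈ Ioo 0 t₀, 0 < JFun ρ lbar t ∧ ∀ x ∈ Ioc (0 : ℝ) 1,
      JFun ρ lbar (x * t) ≤ x ^ (ρ - η) * JFun ρ lbar t := by
  obtain ⟨t₀, ht₀, h⟩ := hL.lbar_potter hη
  refine ⟨t₀, ht₀, fun t ht => ⟨mul_pos (Real.rpow_pos_of_pos ht.1 _) (h t ht).1,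
    fun x hx => ?_⟩⟩
  have h1 := (h t ht).2 x hx
  have h2 := Real.rpow_pos_of_pos ht.1 ρ
  have h3 := Real.rpow_pos_of_pos hx.1 ρ
  rw [JFun, JFun, Real.mul_rpow hx.1.le ht.1.le, sub_eq_add_neg, Real.rpow_add hx.1]
  calc x ^ ρ * t ^ ρ * lbar (x * t) ≤ x ^ ρ * t ^ ρ * (x ^ (-η) * lbar t) := by gcongr
    _ = _ := by ring

theorem LbarCond.tendsto_JFun_ratio {Lbar lbar : ℝ → ℝ} {ρ : ℝ} (hL : LbarCond Lbar ρ lbar)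
    {x : ℝ} (hx : 0 < x) :
    Tendsto (fun t => JFun ρ lbar (x * t) / JFun ρ lbar t) (𝓝[>] 0) (𝓝 (x ^ ρ)) := by
  obtain ⟨δ', hδ', -, -, h⟩ := hL.slow
  have h1 := (h x hx).const_mul (x ^ ρ)
  rw [mul_one] at h1
  refine h1.congr' ?_
  filter_upwards [self_mem_nhdsWithin] with t ht
  have h2 := (Real.rpow_pos_of_pos ht ρ).ne'
  rw [JFun, JFun, Real.mul_rpow hx.le (le_of_lt ht)]
  field_simp

/-! ### Lebesgue-Stieltjes integrals -/

instance isLocallyFiniteMeasure_lsMeasure (g : ℝ → ℝ) (a b : ℝ) :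
    IsLocallyFiniteMeasure (lsMeasure g a b) := by
  unfold lsMeasure
  split_ifs <;> infer_instance

/-- `lsMeasure g a b` depends on its endpoints through the clamping. Agreement on half-open
intervals allows all integrals to be taken against one ambient measure, so that they add over
adjacent intervals. -/
theorem lsMeasure_restrict {g : ℝ → ℝ} {A B x y : ℝ} (hg : MonotoneOn g (Icc A B))
    (hc : ∀ t ∈ Ioc A B, ContinuousWithinAt g (Iio t) t) (hAx : A ≤ x) (hxy : x ≤ y)
    (hyB : y ≤ B) :
    (lsMeasure g x y).restrict (Ico x y) = (lsMeasure g A B).restrict (Ico x y) := by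
  have hg' : MonotoneOn g (Icc x y) := hg.mono (Icc_subset_Icc hAx hyB)
  have hc' : ∀ t ∈ Ioc x y, ContinuousWithinAt g (Iio t) t :=
    fun t ht => hc t ⟨hAx.trans_lt ht.1, ht.2.trans hyB⟩
  have hfin : IsFiniteMeasure ((lsMeasure g x y).restrict (Ico x y)) := by
    refine ⟨?_⟩
    rw [Measure.restrict_apply_univ, lsMeasure_Ico hg' hc' le_rfl hxy le_rfl]
    exact ENNReal.ofReal_lt_top
  refine Measure.ext_of_Ico_finite _ _ ?_ fun a b _ => ?_
  · rw [Measure.restrict_apply_univ, Measure.restrict_apply_univ,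
      lsMeasure_Ico hg' hc' le_rfl hxy le_rfl, lsMeasure_Ico hg hc hAx hxy hyB]
  · rw [Measure.restrict_apply measurableSet_Ico, Measure.restrict_apply measurableSet_Ico,
      Ico_inter_Ico]
    rcases le_or_gt (max a x) (min b y) with h | h
    · rw [lsMeasure_Ico hg' hc' (le_max_right _ _) h (min_le_right _ _),
        lsMeasure_Ico hg hc (hAx.trans (le_max_right _ _)) h ((min_le_right _ _).trans hyB)]
    · rw [Ico_eq_empty (not_lt.2 h.le), measure_empty, measure_empty]

theorem lsIntegral_eq {g h : ℝ → ℝ} {A B x y : ℝ} (hg : MonotoneOn g (Icc A B))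
    (hc : ∀ t ∈ Ioc A B, ContinuousWithinAt g (Iio t) t) (hAx : A ≤ x) (hxy : x ≤ y)
    (hyB : y ≤ B) : lsIntegral h g x y = ∫ u in Ico x y, h u ∂(lsMeasure g A B) := by
  rw [lsIntegral, lsMeasure_restrict hg hc hAx hxy hyB]

theorem lsMeasure_real_Ico {g : ℝ → ℝ} {a b x y : ℝ} (hg : MonotoneOn g (Icc a b))
    (hc : ∀ t ∈ Ioc a b, ContinuousWithinAt g (Iio t) t)
    (hax : a ≤ x) (hxy : x ≤ y) (hyb : y ≤ b) :
    (lsMeasure g a b).real (Ico x y) = g y - g x := by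
  rw [Measure.real, lsMeasure_Ico hg hc hax hxy hyb, ENNReal.toReal_ofReal]
  exact sub_nonneg.2 (hg ⟨hax, hxy.trans hyb⟩ ⟨hax.trans hxy, hyb⟩ hxy)

/-- The form of Fubini behind both integration by parts (`S = {v < w}`) and the covariance formula
(`S = {w ≤ v}`). -/
theorem integral_indicator_swap {μ ν : Measure ℝ} [IsFiniteMeasure μ] [SFinite ν] {h : ℝ → ℝ}
    (hh : Integrable h ν) {S : Set (ℝ × ℝ)} (hS : MeasurableSet S) :
    ∫ v, ∫ w, S.indicator (fun z => h z.2) (v, w) ∂ν ∂μ =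
      ∫ w, h w * μ.real {v | (v, w) ∈ S} ∂ν := by
  rw [integral_integral_swap]
  · refine integral_congr_ae (Eventually.of_forall fun w => ?_)
    have hm : MeasurableSet {v : ℝ | (v, w) ∈ S} := (measurable_id.prodMk measurable_const) hS
    have : (fun v => S.indicator (fun z : ℝ × ℝ => h z.2) (v, w)) =
        {v | (v, w) ∈ S}.indicator fun _ => h w := by
      ext v; by_cases hv : (v, w) ∈ S <;> simp [indicator, hv]
    simp only [this]
    rw [integral_indicator_const _ hm, smul_eq_mul, mul_comm]
  · exact (hh.comp_snd μ).indicator hS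

/-- Integration by parts for a Lebesgue-Stieltjes integral. -/
theorem setIntegral_Ico_by_parts {ν : Measure ℝ} {g J J' : ℝ → ℝ} {a b : ℝ} (hab : a ≤ b)
    (hfin : ν (Ico a b) ≠ ⊤) (hν : ∀ z ∈ Icc a b, ν.real (Ico a z) = g z - g a)
    (hJ : ∀ z ∈ Icc a b, HasDerivAt J (J' z) z) (hJ' : ContinuousOn J' (Icc a b)) :
    ∫ u in Ico a b, J u ∂ν = J b * (g b - g a) - ∫ z in a..b, J' z * (g z - g a) := by
  have : IsFiniteMeasure (ν.restrict (Ico a b)) :=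
    ⟨by rw [Measure.restrict_apply_univ]; exact hfin.lt_top⟩
  have hint : IntegrableOn J' (Ioc a b) := (hJ'.integrableOn_Icc).mono_set Ioc_subset_Icc_self
  -- `J b - J u` is the integral of `J'` over `w > u`; after the swap the section of `S` has mass `ν
  -- [a, w) = g w - g a`, the strict inequality matching the half-open convention.
  set S : Set (ℝ × ℝ) := {z | z.1 < z.2} with hS
  have hSm : MeasurableSet S := measurableSet_lt measurable_fst measurable_snd
  have key := integral_indicator_swap (μ := ν.restrict (Ico a b)) hint hSm
  have hl : ∀ u ∈ Ico a b, ∫ w in Ioc a b, S.indicator (fun z => J' z.2) (u, w) = J b - J u := by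
    intro u hu
    have h1 : (fun w => S.indicator (fun z : ℝ × ℝ => J' z.2) (u, w)) = (Ioi u).indicator J' := by
      ext w; by_cases hw : u < w <;> simp [indicator, hS, hw]
    rw [h1, setIntegral_indicator measurableSet_Ioi, Ioc_inter_Ioi, sup_eq_right.2 hu.1,
      ← intervalIntegral.integral_of_le hu.2.le]
    refine intervalIntegral.integral_eq_sub_of_hasDerivAt (fun z hz => ?_) ?_
    · rw [uIcc_of_le hu.2.le] at hz
      exact hJ z ⟨hu.1.trans hz.1, hz.2⟩
    · refine (hJ'.mono ?_).intervalIntegrable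
      rw [uIcc_of_le hu.2.le]
      exact Icc_subset_Icc_left hu.1
  rw [setIntegral_congr_fun measurableSet_Ico hl] at key
  have hJint : IntegrableOn J (Ico a b) ν := by
    refine Integrable.of_bound (C := ⨆ z : Icc a b, ‖J z‖) ?_ ?_
    · exact ContinuousOn.aestronglyMeasurable
        (fun z hz => (hJ z ⟨hz.1, hz.2.le⟩).continuousAt.continuousWithinAt) measurableSet_Ico
    · refine (ae_restrict_mem measurableSet_Ico).mono fun z hz => ?_
      have hb : BddAbove (range fun z : Icc a b => ‖J z‖) := by
        have := isCompact_Icc.bddAbove_image (f := fun z => ‖J z‖) (K := Icc a b)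
          (fun z hz => (hJ z hz).continuousAt.norm.continuousWithinAt)
        rwa [image_eq_range] at this
      exact le_ciSup hb ⟨z, hz.1, hz.2.le⟩
  rw [integral_sub (integrable_const _) hJint, integral_const, smul_eq_mul,
    measureReal_restrict_apply_univ, hν b ⟨hab, le_rfl⟩] at key
  have hr : ∫ w in Ioc a b, J' w * (ν.restrict (Ico a b)).real {v | (v, w) ∈ S} =
      ∫ z in a..b, J' z * (g z - g a) := by
    rw [intervalIntegral.integral_of_le hab]
    refine setIntegral_congr_fun measurableSet_Ioc fun w hw => ?_
    have h1 : {v : ℝ | (v, w) ∈ S} = Iio w := rfl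
    rw [h1, measureReal_restrict_apply measurableSet_Iio, inter_comm, Ico_inter_Iio,
      min_eq_right hw.2, hν w ⟨hw.1.le, hw.2⟩]
  rw [hr] at key
  linarith

/-- The covariance double integral as an integral of squared tail masses. -/
theorem integral_integral_min_sub_mul {μ : Measure ℝ} [IsFiniteMeasure μ] {t : ℝ} (ht : 0 ≤ t)
    (hμ : ∀ᵐ u ∂μ, u ∈ Ico 0 t) :
    ∫ v, ∫ u, (min u v - u * v) ∂μ ∂μ =
      (∫ w in (0 : ℝ)..t, μ.real (Ici w) ^ 2) - (∫ w in (0 : ℝ)..t, μ.real (Ici w)) ^ 2 := by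
  set m : ℝ → ℝ := fun w => μ.real (Ici w) with hm
  have hanti : Antitone m := fun a b hab => measureReal_mono (Ici_subset_Ici.2 hab)
  have hmint : IntegrableOn m (Ioc 0 t) :=
    (hanti.antitoneOn _).integrableOn_isCompact isCompact_Icc |>.mono_set Ioc_subset_Icc_self
  -- Layer-cake: `u` and `min u v` are lengths of sets of levels `w`, and the section of `S` at
  -- level `w` is `Ici w`, of mass `m w`.
  set S : Set (ℝ × ℝ) := {z | z.2 ≤ z.1} with hS
  have hSm : MeasurableSet S := measurableSet_le measurable_snd measurable_fst
  have hSv : ∀ w, {v : ℝ | (v, w) ∈ S} = Ici w := fun w => rfl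
  have hind : ∀ (h : ℝ → ℝ) (v : ℝ), v ∈ Icc 0 t →
      ∫ w in Ioc 0 t, S.indicator (fun z => h z.2) (v, w) = ∫ w in Ioc 0 v, h w := by
    intro h v hv
    have h1 : (fun w => S.indicator (fun z : ℝ × ℝ => h z.2) (v, w)) = (Iic v).indicator h := by
      ext w; by_cases hw : w ≤ v <;> simp [indicator, hS, hw]
    rw [h1, setIntegral_indicator measurableSet_Iic, Ioc_inter_Iic, inf_eq_right.2 hv.2]
  have hmin : ∀ v ∈ Icc 0 t, ∫ u, min u v ∂μ = ∫ w in Ioc 0 v, m w := by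
    intro v hv
    have hI : IntegrableOn ((Iic v).indicator fun _ => (1 : ℝ)) (Ioc 0 t) :=
      (integrable_const _).indicator measurableSet_Iic
    have key := integral_indicator_swap (μ := μ) hI hSm
    calc ∫ u, min u v ∂μ
        = ∫ u, (∫ w in Ioc 0 t,
            S.indicator (fun z => (Iic v).indicator (fun _ => (1 : ℝ)) z.2) (u, w)) ∂μ := by
          refine integral_congr_ae (hμ.mono fun u hu => ?_)
          beta_reduce
          rw [hind _ u ⟨hu.1, hu.2.le⟩, setIntegral_indicator measurableSet_Iic, Ioc_inter_Iic]
          simp [hu.1, hv.1]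
      _ = ∫ w in Ioc 0 v, m w := by
          rw [key]
          simp only [hSv]
          have h1 : (fun w => (Iic v).indicator (fun _ => (1 : ℝ)) w * μ.real (Ici w)) =
              (Iic v).indicator m := by
            ext w; by_cases hw : w ≤ v <;> simp [indicator, hm, hw]
          rw [h1, setIntegral_indicator measurableSet_Iic, Ioc_inter_Iic, inf_eq_right.2 hv.2]
  have hu1 : ∫ u, u ∂μ = ∫ w in Ioc 0 t, m w := by
    rw [← hmin t ⟨ht, le_rfl⟩]
    exact integral_congr_ae (hμ.mono fun u hu => (min_eq_left hu.2.le).symm)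
  have hbd : ∀ {f : ℝ → ℝ}, Measurable f → (∀ u ∈ Ico 0 t, ‖f u‖ ≤ t) → Integrable f μ :=
    fun hf hb => Integrable.of_bound hf.aestronglyMeasurable t (hμ.mono hb)
  have hid : Integrable (fun u : ℝ => u) μ := hbd measurable_id fun u hu => by
    rw [Real.norm_of_nonneg hu.1]; exact hu.2.le
  -- The inner integral is `∫_0^v m - v ∫_0^t m`. A second swap in `v` turns the first term into `∫
  -- m · m`, and the mean of `v` is again `∫ m`.
  have hinner : ∀ᵐ v ∂μ, ∫ u, (min u v - u * v) ∂μ =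
      (∫ w in Ioc 0 t, S.indicator (fun z => m z.2) (v, w)) - (∫ w in Ioc 0 t, m w) * v := by
    filter_upwards [hμ] with v hv
    rw [integral_sub _ (hid.mul_const v), integral_mul_const, hu1, hmin v ⟨hv.1, hv.2.le⟩,
      hind m v ⟨hv.1, hv.2.le⟩]
    refine hbd (measurable_id.min measurable_const) fun u hu => ?_
    rw [Real.norm_of_nonneg (le_min hu.1 hv.1)]
    exact (min_le_left _ _).trans hu.2.le
  have hint : Integrable (fun v => ∫ w in Ioc 0 t, S.indicator (fun z => m z.2) (v, w)) μ :=
    (((hmint.integrable).comp_snd μ).indicator hSm).integral_prod_left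
  rw [integral_congr_ae hinner, integral_sub hint (hid.const_mul _), integral_const_mul, hu1,
    integral_indicator_swap hmint hSm, intervalIntegral.integral_of_le ht,
    intervalIntegral.integral_of_le ht]
  simp only [hSv, sq, hm]

/-! ### The integrator `K` and the variance `σ²` -/

theorem LbarCond.continuousOn_JFun {Lbar lbar : ℝ → ℝ} {ρ : ℝ} (hL : LbarCond Lbar ρ lbar) :
    ContinuousOn (JFun ρ lbar) (Ioo 0 1) := by
  have h1 : ContinuousOn (fun t : ℝ => Lbar (1 - t)) (Ioo 0 1) :=
    hL.cont.comp (by fun_prop) fun t ht => ⟨by linarith [ht.2], by linarith [ht.1]⟩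
  exact h1.congr fun t ht => (hL.factor t ht).symm

theorem LbarCond.JFun_nonneg {Lbar lbar : ℝ → ℝ} {ρ : ℝ} (hL : LbarCond Lbar ρ lbar) {t : ℝ}
    (ht : t ∈ Ioo (0 : ℝ) 1) : 0 ≤ JFun ρ lbar t := by
  rw [JFun, ← hL.factor t ht]
  exact hL.nonneg _ ⟨by linarith [ht.2], by linarith [ht.1]⟩

section KFun

variable {P : Measure ℝ} {p ρ : ℝ} {Lbar lbar : ℝ → ℝ}

/-- The base point `1/2` may lie on either side of `x` and `y`. On an interval `[A, B]` containing
all three points, every integral refers to the same measure and additivity cancels the base point.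
-/
theorem KFun_sub (h0 : ∀ x < 1, cdf P x = 0) (hp : 0 < p) (hL : LbarCond Lbar ρ lbar) {x y : ℝ}
    (hx : 0 < x) (hxy : x ≤ y) (hy : y < 1) :
    KFun P p ρ lbar y - KFun P p ρ lbar x =
      ∫ u in Ico x y, JFun ρ lbar u ∂(lsMeasure (gFun P p) x y) := by
  set A := min x (1 / 2) with hA
  set B := max y (1 / 2) with hB
  have hA0 : 0 < A := lt_min hx (by norm_num)
  have hB1 : B < 1 := max_lt hy (by norm_num)
  have hAx : A ≤ x := min_le_left _ _
  have hA2 : A ≤ 1 / 2 := min_le_right _ _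
  have hyB : y ≤ B := le_max_left _ _
  have h2B : 1 / 2 ≤ B := le_max_right _ _
  have hsub : Icc A B ⊆ Ioo 0 1 := fun t ht => ⟨hA0.trans_le ht.1, ht.2.trans_lt hB1⟩
  have hg := (monotoneOn_gFun h0 hp).mono hsub
  have hc : ∀ t ∈ Ioc A B, ContinuousWithinAt (gFun P p) (Iio t) t :=
    fun t ht => gFun_leftCont h0 hp (hsub (Ioc_subset_Icc_self ht))
  set ν := lsMeasure (gFun P p) A B with hν
  have hint : IntegrableOn (JFun ρ lbar) (Icc A B) ν :=
    (hL.continuousOn_JFun.mono hsub).integrableOn_compact isCompact_Icc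
  have hadd : ∀ a b, A ≤ a → a ≤ b → b ≤ B → ∫ u in Ico A b, JFun ρ lbar u ∂ν =
      (∫ u in Ico A a, JFun ρ lbar u ∂ν) + ∫ u in Ico a b, JFun ρ lbar u ∂ν := by
    intro a b ha hab hb
    rw [← Ico_union_Ico_eq_Ico ha hab]
    refine setIntegral_union ?_ measurableSet_Ico (hint.mono_set ?_) (hint.mono_set ?_)
    · exact Set.disjoint_left.2 fun z h1 h2 => absurd h1.2 (not_lt.2 h2.1)
    · exact fun z hz => ⟨hz.1, (hz.2.le.trans hab).trans hb⟩
    · exact fun z hz => ⟨ha.trans hz.1, hz.2.le.trans hb⟩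
  have hK : ∀ t ∈ Icc A B, KFun P p ρ lbar t =
      (∫ u in Ico A t, JFun ρ lbar u ∂ν) - ∫ u in Ico A (1 / 2), JFun ρ lbar u ∂ν := by
    intro t ht
    unfold KFun
    split_ifs with h
    · rw [lsIntegral_eq hg hc hA2 h ht.2, hadd _ _ hA2 h ht.2]
      ring
    · rw [lsIntegral_eq hg hc ht.1 (not_le.1 h).le h2B, hadd _ _ ht.1 (not_le.1 h).le h2B]
      ring
  rw [hK y ⟨hAx.trans hxy, hyB⟩, hK x ⟨hAx, hxy.trans hyB⟩, hadd _ _ hAx hxy hyB,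
    lsMeasure_restrict hg hc hAx hxy hyB]
  ring

theorem KFun_sub_nonneg (h0 : ∀ x < 1, cdf P x = 0) (hp : 0 < p) (hL : LbarCond Lbar ρ lbar)
    {x y : ℝ} (hx : 0 < x) (hxy : x ≤ y) (hy : y < 1) :
    0 ≤ KFun P p ρ lbar y - KFun P p ρ lbar x := by
  rw [KFun_sub h0 hp hL hx hxy hy]
  exact setIntegral_nonneg measurableSet_Ico fun u hu =>
    hL.JFun_nonneg ⟨hx.trans_le hu.1, hu.2.trans hy⟩

theorem lsMeasure_gFun_real (h0 : ∀ x < 1, cdf P x = 0) (hp : 0 < p) {x y z : ℝ}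
    (hx : 0 < x) (hy : y < 1) (hz : z ∈ Icc x y) :
    (lsMeasure (gFun P p) x y).real (Ico x z) = gFun P p z - gFun P p x :=
  lsMeasure_real_Ico
    ((monotoneOn_gFun h0 hp).mono fun _ ht => ⟨hx.trans_le ht.1, ht.2.trans_lt hy⟩)
    (fun _ ht => gFun_leftCont h0 hp ⟨hx.trans ht.1, ht.2.trans_lt hy⟩) le_rfl hz.1 hz.2

theorem KFun_sub_le (h0 : ∀ x < 1, cdf P x = 0) (hp : 0 < p) (hL : LbarCond Lbar ρ lbar)
    {x y M : ℝ} (hx : 0 < x) (hxy : x ≤ y) (hy : y < 1)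
    (hM : ∀ u ∈ Ico x y, JFun ρ lbar u ≤ M) :
    KFun P p ρ lbar y - KFun P p ρ lbar x ≤ M * (gFun P p y - gFun P p x) := by
  have h1 := norm_setIntegral_le_of_norm_le_const (μ := lsMeasure (gFun P p) x y) (C := M)
    (f := JFun ρ lbar) (s := Ico x y) measure_Ico_lt_top fun u hu => by
      rw [Real.norm_of_nonneg (hL.JFun_nonneg ⟨hx.trans_le hu.1, hu.2.trans hy⟩)]
      exact hM u hu
  rw [← KFun_sub h0 hp hL hx hxy hy, lsMeasure_gFun_real h0 hp hx hy ⟨hxy, le_rfl⟩] at h1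
  exact (le_abs_self _).trans h1

theorem monotoneOn_KFun (h0 : ∀ x < 1, cdf P x = 0) (hp : 0 < p) (hL : LbarCond Lbar ρ lbar) :
    MonotoneOn (KFun P p ρ lbar) (Ioo 0 1) := fun _ hx _ hy hxy =>
  sub_nonneg.1 (KFun_sub_nonneg h0 hp hL hx.1 hxy hy.2)

/-- Left continuity passes from `g` to `K` because `J` is bounded on compact subintervals of `(0,
1)`. -/
theorem KFun_leftCont (h0 : ∀ x < 1, cdf P x = 0) (hp : 0 < p) (hL : LbarCond Lbar ρ lbar)
    {t : ℝ} (ht : t ∈ Ioo (0 : ℝ) 1) :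
    ContinuousWithinAt (KFun P p ρ lbar) (Iio t) t := by
  have hlt : t / 2 < t := by linarith [ht.1]
  have hpos : 0 < t / 2 := by linarith [ht.1]
  obtain ⟨M, hM⟩ := isCompact_Icc.bddAbove_image (f := JFun ρ lbar) (K := Icc (t / 2) t)
    (hL.continuousOn_JFun.mono fun z hz => ⟨hpos.trans_le hz.1, hz.2.trans_lt ht.2⟩)
  have h1 : Tendsto (fun x => M * (gFun P p t - gFun P p x)) (𝓝[<] t) (𝓝 0) := by
    have := ((gFun_leftCont h0 hp ht).tendsto.const_sub (gFun P p t)).const_mul M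
    simpa using this
  have h2 : Tendsto (fun x => KFun P p ρ lbar t - KFun P p ρ lbar x) (𝓝[<] t) (𝓝 0) := by
    refine squeeze_zero' ?_ ?_ h1
    · filter_upwards [Ioo_mem_nhdsLT hlt] with x hx
      exact KFun_sub_nonneg h0 hp hL (hpos.trans hx.1) hx.2.le ht.2
    · filter_upwards [Ioo_mem_nhdsLT hlt] with x hx
      exact KFun_sub_le h0 hp hL (hpos.trans hx.1) hx.2.le ht.2 fun u hu =>
        hM ⟨u, ⟨hx.1.le.trans hu.1, hu.2.le⟩, rfl⟩
  have h3 := h2.const_sub (KFun P p ρ lbar t)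
  simpa [ContinuousWithinAt] using h3

/-- The restriction of `dK` to `[s, t)` is viewed as a measure on `[0, t)`; its mass on `[w, ∞)` is
`K(t) - K(max s w)`, constant for `w ≤ s`. -/
theorem sigma_eq (h0 : ∀ x < 1, cdf P x = 0) (hp : 0 < p) (hL : LbarCond Lbar ρ lbar)
    {s t : ℝ} (hs : 0 < s) (hst : s ≤ t) (ht : t < 1) :
    sigma P p ρ lbar s t =
      √((∫ w in (0 : ℝ)..t, (KFun P p ρ lbar t - KFun P p ρ lbar (max s w)) ^ 2) -
        (∫ w in (0 : ℝ)..t, (KFun P p ρ lbar t - KFun P p ρ lbar (max s w))) ^ 2) := by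
  have ht0 : 0 < t := hs.trans_le hst
  have hsub : Icc s t ⊆ Ioo 0 1 := fun z hz => ⟨hs.trans_le hz.1, hz.2.trans_lt ht⟩
  have hK := (monotoneOn_KFun h0 hp hL).mono hsub
  have hc : ∀ z ∈ Ioc s t, ContinuousWithinAt (KFun P p ρ lbar) (Iio z) z :=
    fun z hz => KFun_leftCont h0 hp hL (hsub (Ioc_subset_Icc_self hz))
  set μ := (lsMeasure (KFun P p ρ lbar) s t).restrict (Ico s t) with hμ
  have : IsFiniteMeasure μ := ⟨by
    rw [hμ, Measure.restrict_apply_univ]; exact measure_Ico_lt_top⟩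
  have hae : ∀ᵐ u ∂μ, u ∈ Ico 0 t :=
    (ae_restrict_mem measurableSet_Ico).mono fun u hu => ⟨hs.le.trans hu.1, hu.2⟩
  have key := integral_integral_min_sub_mul ht0.le hae
  have hm : ∀ w ∈ Ioc 0 t, μ.real (Ici w) = KFun P p ρ lbar t - KFun P p ρ lbar (max s w) := by
    intro w hw
    have h1 : Ici w ∩ Ico s t = Ico (max s w) t := by
      ext z
      simp only [mem_inter_iff, mem_Ici, mem_Ico, max_le_iff]
      tauto
    rw [hμ, measureReal_restrict_apply measurableSet_Ici, h1,
      lsMeasure_real_Ico hK hc (le_max_left _ _) (max_le hst hw.2) le_rfl]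
  have e1 : ∫ w in (0 : ℝ)..t, μ.real (Ici w) =
      ∫ w in (0 : ℝ)..t, (KFun P p ρ lbar t - KFun P p ρ lbar (max s w)) := by
    rw [intervalIntegral.integral_of_le ht0.le, intervalIntegral.integral_of_le ht0.le]
    exact setIntegral_congr_fun measurableSet_Ioc hm
  have e2 : ∫ w in (0 : ℝ)..t, μ.real (Ici w) ^ 2 =
      ∫ w in (0 : ℝ)..t, (KFun P p ρ lbar t - KFun P p ρ lbar (max s w)) ^ 2 := by
    rw [intervalIntegral.integral_of_le ht0.le, intervalIntegral.integral_of_le ht0.le]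
    exact setIntegral_congr_fun measurableSet_Ioc fun w hw => by simp only [hm w hw]
  rw [e1, e2] at key
  rw [← key]
  rfl

end KFun

/-! ### Increments of `K` near zero -/

section KFun

variable {P : Measure ℝ} {γ p ρ : ℝ} {Lbar lbar : ℝ → ℝ}

theorem LbarCond.JFun_le (hL : LbarCond Lbar ρ lbar) {r : ℝ} (hr : -ρ < r) :
    ∃ t₀ ∈ Ioo (0 : ℝ) 1, ∀ t ∈ Ioo 0 t₀, 0 < JFun ρ lbar t ∧ ∀ x ∈ Ioc (0 : ℝ) 1,
      JFun ρ lbar (x * t) ≤ x ^ (-r) * JFun ρ lbar t := by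
  obtain ⟨t₀, ht₀, h⟩ := hL.JFun_potter (η := r + ρ) (by linarith)
  have e : ρ - (r + ρ) = -r := by ring
  rw [e] at h
  exact ⟨t₀, ht₀, h⟩

/-- The exponent is split as `β = r + (β - r)` with `r > max(0, -ρ)`: the supremum of `J` over `[x
t, t)` costs `x^(-r)`, and the increment of `g` costs `x^(-(β - r))`. -/
theorem exists_KFun_sub_bound (hF : MemR γ P) (hγ : 0 < γ) (hp : 0 < p)
    (hL : LbarCond Lbar ρ lbar) {β : ℝ} (hβ : 0 < β) (hβρ : -ρ < β) :
    ∃ B, 0 < B ∧ ∃ t₀ ∈ Ioo (0 : ℝ) 1, ∀ t ∈ Ioo 0 t₀, ∀ x ∈ Ioc (0 : ℝ) 1,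
      KFun P p ρ lbar t - KFun P p ρ lbar (x * t) ≤
        B * x ^ (-β) * (JFun ρ lbar t * (-Real.log t) ^ (p - 1)) := by
  have h0 : ∀ x < 1, cdf P x = 0 := fun _ => hF.cdf_eq_zero
  obtain ⟨r, hr1, hr2⟩ := exists_between (max_lt hβ hβρ)
  obtain ⟨t₁, ht₁, hJ⟩ := hL.JFun_le ((le_max_right _ _).trans_lt hr1)
  have hr0 : 0 < r := (le_max_left _ _).trans_lt hr1
  obtain ⟨B, hB, t₂, ht₂, hG⟩ := hF.exists_gFun_sub_bound hγ hp (η := β - r) (by linarith)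
  refine ⟨B, hB, min t₁ t₂, ⟨lt_min ht₁.1 ht₂.1, (min_le_left _ _).trans_lt ht₁.2⟩,
    fun t ht x hx => ?_⟩
  have ht1 : t ∈ Ioo 0 t₁ := ⟨ht.1, ht.2.trans_le (min_le_left _ _)⟩
  have hxt : x * t ≤ t := by nlinarith [hx.1, hx.2, ht.1]
  have hxt0 : 0 < x * t := mul_pos hx.1 ht.1
  obtain ⟨hJt, hJx⟩ := hJ t ht1
  have h1 : ∀ u ∈ Ico (x * t) t, JFun ρ lbar u ≤ x ^ (-r) * JFun ρ lbar t := by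
    intro u hu
    have hu0 : 0 < u := hxt0.trans_le hu.1
    have h2 : x ≤ u / t := (le_div_iff₀ ht.1).2 hu.1
    have h3 := hJx (u / t) ⟨div_pos hu0 ht.1, (div_le_one ht.1).2 hu.2.le⟩
    rw [div_mul_cancel₀ _ ht.1.ne'] at h3
    exact h3.trans (mul_le_mul_of_nonneg_right
      (Real.rpow_le_rpow_of_nonpos hx.1 h2 (by linarith)) hJt.le)
  have h4 := KFun_sub_le h0 hp hL hxt0 hxt (ht1.2.trans ht₁.2) h1
  have h5 := hG t ⟨ht.1, ht.2.trans_le (min_le_right _ _)⟩ x hx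
  have h6 : x ^ (-β) = x ^ (-r) * x ^ (-(β - r)) := by
    rw [← Real.rpow_add hx.1]; ring_nf
  calc _ ≤ x ^ (-r) * JFun ρ lbar t * (gFun P p t - gFun P p (x * t)) := h4
    _ ≤ x ^ (-r) * JFun ρ lbar t * (B * x ^ (-(β - r)) * (-Real.log t) ^ (p - 1)) := by
        have := Real.rpow_pos_of_pos hx.1 (-r)
        exact mul_le_mul_of_nonneg_left h5 (by positivity)
    _ = _ := by rw [h6]; ring

theorem LbarCond.exists_hasDerivAt_JFun (hL : LbarCond Lbar ρ lbar) :
    ∃ (δ : ℝ) (ε : ℝ → ℝ), δ ∈ Ioc (0 : ℝ) 1 ∧ ContinuousOn ε (Ioo 0 δ) ∧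
      Tendsto ε (𝓝[>] 0) (𝓝 0) ∧
      ∀ t ∈ Ioo 0 δ, HasDerivAt (JFun ρ lbar) (t⁻¹ * JFun ρ lbar t * (ρ + ε t)) t := by
  obtain ⟨δ, ε, hδ, hδ1, hc, hε, hd⟩ := hL.deriv
  refine ⟨δ, ε, ⟨hδ, hδ1⟩, hc, hε, fun t ht => ?_⟩
  have h1 := (Real.hasDerivAt_rpow_const (p := ρ) (Or.inl ht.1.ne')).mul (hd t ht)
  have e : t⁻¹ * JFun ρ lbar t * (ρ + ε t) =
      ρ * t ^ (ρ - 1) * lbar t + t ^ ρ * (t⁻¹ * lbar t * ε t) := by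
    have := ht.1.ne'
    rw [Real.rpow_sub_one this, JFun]
    field_simp
  rw [e]
  exact h1

/-- Integration by parts of `∫ z^ρ d(log z)`, with antiderivative `z^ρ (log z - log x)`. It
identifies the limit in `tendsto_KFun_sub`. -/
theorem integral_rpow_mul_log (ρ : ℝ) {x : ℝ} (hx : 0 < x) (hx1 : x ≤ 1) :
    -Real.log x - ∫ z in x..1, z⁻¹ * z ^ ρ * ρ * (-Real.log x - -Real.log z) =
      ∫ z in x..1, z ^ (ρ - 1) := by
  have hpos : ∀ z ∈ uIcc x 1, 0 < z := fun z hz => by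
    rw [uIcc_of_le hx1] at hz; exact hx.trans_le hz.1
  have hlog : ContinuousOn Real.log (uIcc x 1) :=
    Real.continuousOn_log.mono fun z hz => (hpos z hz).ne'
  have hpow : ∀ a : ℝ, ContinuousOn (fun z : ℝ => z ^ a) (uIcc x 1) := fun a =>
    continuousOn_id.rpow_const fun z hz => Or.inl (hpos z hz).ne'
  have hi1 : IntervalIntegrable (fun z : ℝ => z⁻¹ * z ^ ρ * ρ * (-Real.log x - -Real.log z))
      volume x 1 := by
    refine ContinuousOn.intervalIntegrable ?_
    have hinv : ContinuousOn (fun z : ℝ => z⁻¹) (uIcc x 1) :=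
      continuousOn_id.inv₀ fun z hz => (hpos z hz).ne'
    exact ((hinv.mul (hpow ρ)).mul continuousOn_const).mul (continuousOn_const.sub hlog.neg)
  have hi2 : IntervalIntegrable (fun z : ℝ => z ^ (ρ - 1)) volume x 1 :=
    (hpow _).intervalIntegrable
  have h1 : ∫ z in x..1, (z⁻¹ * z ^ ρ * ρ * (-Real.log x - -Real.log z) + z ^ (ρ - 1)) =
      -Real.log x := by
    have := intervalIntegral.integral_eq_sub_of_hasDerivAt
      (f := fun z => z ^ ρ * (Real.log z - Real.log x)) (a := x) (b := 1)
      (f' := fun z => z⁻¹ * z ^ ρ * ρ * (-Real.log x - -Real.log z) + z ^ (ρ - 1))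
      (fun z hz => ?_) (hi1.add hi2)
    · rw [this]; simp
    · have hz0 := (hpos z hz).ne'
      have h2 := (Real.hasDerivAt_rpow_const (p := ρ) (Or.inl hz0)).mul
        ((Real.hasDerivAt_log hz0).sub_const (Real.log x))
      refine HasDerivAt.congr_deriv h2 ?_
      rw [Real.rpow_sub_one hz0]
      field_simp
      ring
  rw [intervalIntegral.integral_add hi1 hi2] at h1
  linarith

/-- Increments of `K` over geometric steps. -/
theorem tendsto_KFun_sub (hF : MemR γ P) (hγ : 0 < γ) (hp : 0 < p)
    (hL : LbarCond Lbar ρ lbar) {x : ℝ} (hx : 0 < x) (hx1 : x ≤ 1) :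
    Tendsto (fun t => (KFun P p ρ lbar t - KFun P p ρ lbar (x * t)) /
      (JFun ρ lbar t * (-Real.log t) ^ (p - 1))) (𝓝[>] 0)
      (𝓝 (p * γ ^ p * ∫ z in x..1, z ^ (ρ - 1))) := by
  have h0 : ∀ x < 1, cdf P x = 0 := fun _ => hF.cdf_eq_zero
  obtain ⟨δ, ε, hδ, hεc, hε, hd⟩ := hL.exists_hasDerivAt_JFun
  -- A crude exponent suffices here: `x` is fixed and `z` stays in `[x, 1]`, so only a constant
  -- dominating function is needed.
  set r : ℝ := |ρ| + 1 with hr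
  have hr0 : 0 < r := by positivity
  obtain ⟨t₁, ht₁, hJ⟩ := hL.JFun_le (r := r) (by have := neg_abs_le ρ; linarith [abs_nonneg ρ])
  obtain ⟨B, hB, t₂, ht₂, hG⟩ := hF.exists_gFun_sub_bound hγ hp zero_lt_one
  set l : ℝ → ℝ := fun t => (-Real.log t) ^ (p - 1) with hl
  have hlpos : ∀ᶠ t in 𝓝[>] 0, 0 < l t := by
    filter_upwards [tendsto_neg_log_nhdsGT_zero.eventually_gt_atTop 0] with t ht
    exact Real.rpow_pos_of_pos ht _
  have hε1 : ∀ᶠ t in 𝓝[>] (0 : ℝ), |ε t| ≤ 1 := by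
    have := (tendsto_order.1 hε.abs).2 1 (by simp)
    exact this.mono fun t ht => le_of_lt ht
  obtain ⟨t₃, ht₃, hε2⟩ := mem_nhdsGT_iff_exists_Ioo_subset.1 hε1
  set T := min (min δ t₁) (min t₂ t₃) with hT
  have hT0 : 0 < T := lt_min (lt_min hδ.1 ht₁.1) (lt_min ht₂.1 ht₃)
  have hTδ : T ≤ δ := (min_le_left _ _).trans (min_le_left _ _)
  have hT1 : T ≤ t₁ := (min_le_left _ _).trans (min_le_right _ _)
  have hT2 : T ≤ t₂ := (min_le_right _ _).trans (min_le_left _ _)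
  have hT3 : T ≤ t₃ := (min_le_right _ _).trans (min_le_right _ _)
  -- The normalized integrand after integration by parts and the substitution `w = z t`. It involves
  -- `g` only through increments, whose limits are known; no density of `dg` is required.
  set F : ℝ → ℝ → ℝ := fun t z => z⁻¹ * (JFun ρ lbar (z * t) / JFun ρ lbar t) * (ρ + ε (z * t)) *
    ((gFun P p (z * t) - gFun P p (x * t)) / l t) with hFdef
  have hzt : ∀ t ∈ Ioo 0 T, ∀ z ∈ Icc x 1, z * t ∈ Ioo 0 T := fun t ht z hz =>
    ⟨mul_pos (hx.trans_le hz.1) ht.1, lt_of_le_of_lt (by nlinarith [hz.2, ht.1]) ht.2⟩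
  have hsub : Ioo 0 T ⊆ Ioo 0 1 := Ioo_subset_Ioo_right (hTδ.trans hδ.2)
  have hlim : Tendsto (fun t => (gFun P p t - gFun P p (x * t)) / l t - ∫ z in x..1, F t z)
      (𝓝[>] 0) (𝓝 (p * γ ^ p * ∫ z in x..1, z ^ (ρ - 1))) := by
    have e : p * γ ^ p * ∫ z in x..1, z ^ (ρ - 1) = p * γ ^ p * -Real.log x -
        ∫ z in x..1, z⁻¹ * z ^ ρ * (ρ + 0) * (p * γ ^ p * -Real.log x - p * γ ^ p * -Real.log z) := by
      rw [← integral_rpow_mul_log ρ hx hx1, mul_sub, ← intervalIntegral.integral_const_mul]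
      congr 1
      refine intervalIntegral.integral_congr fun z _ => ?_
      ring
    rw [e]
    refine (hF.tendsto_gFun_sub hγ hx hx1).sub ?_
    refine intervalIntegral.tendsto_integral_filter_of_dominated_convergence
      (fun _ => x⁻¹ * x ^ (-r) * (|ρ| + 1) * (B * x ^ (-1 : ℝ))) ?_ ?_ ?_ ?_
    · filter_upwards [eventually_mem_Ioo_zero hT0] with t ht
      rw [uIoc_of_le hx1]
      have hm : ContinuousOn (fun z => z * t) (Ioc x 1) := by fun_prop
      have hmaps : ∀ z ∈ Ioc x 1, z * t ∈ Ioo 0 T := fun z hz =>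
        hzt t ht z (Ioc_subset_Icc_self hz)
      have hcont : ContinuousOn
          (fun z => z⁻¹ * (JFun ρ lbar (z * t) / JFun ρ lbar t) * (ρ + ε (z * t))) (Ioc x 1) := by
        refine ContinuousOn.mul (ContinuousOn.mul ?_ (ContinuousOn.div_const ?_ _))
          (continuousOn_const.add ?_)
        · exact continuousOn_id.inv₀ fun z hz => (hx.trans hz.1).ne'
        · exact hL.continuousOn_JFun.comp hm fun z hz => hsub (hmaps z hz)
        · exact hεc.comp hm fun z hz => Ioo_subset_Ioo_right hTδ (hmaps z hz)
      refine (hcont.aestronglyMeasurable measurableSet_Ioc).mul ?_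
      have hmono : MonotoneOn (fun z => gFun P p (z * t)) (Ioc x 1) := fun a ha b hb hab =>
        monotoneOn_gFun h0 hp (hsub (hmaps a ha)) (hsub (hmaps b hb))
          (mul_le_mul_of_nonneg_right hab ht.1.le)
      exact (((aemeasurable_restrict_of_monotoneOn measurableSet_Ioc hmono).sub_const _).div_const
        _).aestronglyMeasurable
    · filter_upwards [eventually_mem_Ioo_zero hT0, hlpos] with t ht hlt
      refine Eventually.of_forall fun z hz => ?_
      rw [uIoc_of_le hx1] at hz
      have hz0 : 0 < z := hx.trans hz.1
      have hzm := hzt t ht z (Ioc_subset_Icc_self hz)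
      have hxm := hzt t ht x ⟨le_rfl, hx1⟩
      obtain ⟨hJt, hJz⟩ := hJ t ⟨ht.1, ht.2.trans_le hT1⟩
      have hJz0 := (hJ (z * t) ⟨hzm.1, hzm.2.trans_le hT1⟩).1
      have b1 : z⁻¹ ≤ x⁻¹ := inv_anti₀ hx hz.1.le
      have b2 : JFun ρ lbar (z * t) / JFun ρ lbar t ≤ x ^ (-r) := by
        rw [div_le_iff₀ hJt]
        exact (hJz z ⟨hz0, hz.2⟩).trans (mul_le_mul_of_nonneg_right
          (Real.rpow_le_rpow_of_nonpos hx hz.1.le (by linarith)) hJt.le)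
      have b3 : |ρ + ε (z * t)| ≤ |ρ| + 1 :=
        (abs_add_le _ _).trans (add_le_add_right (hε2 ⟨hzm.1, hzm.2.trans_le hT3⟩) _)
      have b4 : (gFun P p (z * t) - gFun P p (x * t)) / l t ≤ B * x ^ (-1 : ℝ) := by
        rw [div_le_iff₀ hlt]
        refine le_trans ?_ (hG t ⟨ht.1, ht.2.trans_le hT2⟩ x ⟨hx, hx1⟩)
        exact sub_le_sub_right (monotoneOn_gFun h0 hp (hsub hzm) (hsub ht)
          (by nlinarith [hz.2, ht.1])) _
      have b4' : 0 ≤ (gFun P p (z * t) - gFun P p (x * t)) / l t :=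
        div_nonneg (sub_nonneg.2 (monotoneOn_gFun h0 hp (hsub hxm) (hsub hzm)
          (mul_le_mul_of_nonneg_right hz.1.le ht.1.le))) hlt.le
      have b2' : 0 ≤ JFun ρ lbar (z * t) / JFun ρ lbar t := (div_pos hJz0 hJt).le
      simp only [hFdef, norm_mul, Real.norm_eq_abs]
      rw [abs_of_nonneg b4', abs_of_nonneg b2', abs_of_nonneg (inv_nonneg.2 hz0.le)]
      gcongr
    · exact intervalIntegrable_const
    · refine Eventually.of_forall fun z hz => ?_
      rw [uIoc_of_le hx1] at hz
      have hz0 : 0 < z := hx.trans hz.1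
      have hcomp : Tendsto (fun t => z * t) (𝓝[>] 0) (𝓝[>] 0) := tendsto_mul_nhdsGT_zero hz0
      refine ((tendsto_const_nhds.mul (hL.tendsto_JFun_ratio hz0)).mul
        ((hε.comp hcomp).const_add ρ)).mul ?_
      refine ((hF.tendsto_gFun_sub hγ hx hx1).sub
        (hF.tendsto_gFun_sub hγ hz0 hz.2)).congr fun t => ?_
      simp only [hl]
      ring
  refine hlim.congr' ?_
  filter_upwards [eventually_mem_Ioo_zero hT0, hlpos] with t ht hlt
  have hxm := hzt t ht x ⟨le_rfl, hx1⟩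
  have hxt : x * t ≤ t := by nlinarith [ht.1]
  have hJt := (hJ t ⟨ht.1, ht.2.trans_le hT1⟩).1
  have hmem : ∀ w ∈ Icc (x * t) t, w ∈ Ioo 0 T := fun w hw =>
    ⟨hxm.1.trans_le hw.1, hw.2.trans_lt ht.2⟩
  have key := setIntegral_Ico_by_parts (ν := lsMeasure (gFun P p) (x * t) t) (g := gFun P p)
    (J := JFun ρ lbar) (J' := fun w => w⁻¹ * JFun ρ lbar w * (ρ + ε w)) hxt
    measure_Ico_lt_top.ne
    (fun z hz => lsMeasure_gFun_real h0 hp hxm.1 (hsub ht).2 hz)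
    (fun z hz => hd z (Ioo_subset_Ioo_right hTδ (hmem z hz))) (by
      refine ContinuousOn.mul (ContinuousOn.mul ?_ ?_) (continuousOn_const.add ?_)
      · exact continuousOn_id.inv₀ fun z hz => (hmem z hz).1.ne'
      · exact hL.continuousOn_JFun.mono fun z hz => hsub (hmem z hz)
      · exact hεc.mono fun z hz => Ioo_subset_Ioo_right hTδ (hmem z hz))
  rw [KFun_sub h0 hp hL hxm.1 hxt (hsub ht).2, key]
  have hsubst := intervalIntegral.mul_integral_comp_mul_right (a := x) (b := 1)
    (f := fun w => w⁻¹ * JFun ρ lbar w * (ρ + ε w) * (gFun P p w - gFun P p (x * t))) t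
  rw [one_mul] at hsubst
  rw [← hsubst, ← intervalIntegral.integral_const_mul]
  refine Eq.trans ?_ (sub_div _ _ _).symm
  rw [← intervalIntegral.integral_div]
  congr 1
  · change _ = _ / (_ * l t)
    field_simp
  · refine intervalIntegral.integral_congr fun z hz => ?_
    rw [uIcc_of_le hx1] at hz
    have hz0 : z ≠ 0 := (hx.trans_le hz.1).ne'
    have ht0 := ht.1.ne'
    change _ = _ / (_ * l t)
    simp only [hFdef]
    field_simp

end KFun

/-! ### Asymptotics of the centering and of the variance -/

/-- The limiting constant for `ρ = 0`, where `∫_x^1 dz/z = -log x`. -/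
theorem integral_log_sq : ∫ x in (0 : ℝ)..1, Real.log x ^ 2 = 2 := by
  set G : ℝ → ℝ := fun x => x * Real.log x ^ 2 - 2 * (x * Real.log x) + 2 * x with hG
  have hderiv : ∀ x ∈ Ioo (0 : ℝ) 1, HasDerivAt G (Real.log x ^ 2) x := by
    intro x hx
    have hx0 := hx.1.ne'
    have hl := Real.hasDerivAt_log hx0
    have h1 := (((hasDerivAt_id x).mul (hl.pow 2)).sub
      (((hasDerivAt_id x).mul hl).const_mul 2)).add ((hasDerivAt_id x).const_mul 2)
    refine HasDerivAt.congr_deriv h1 ?_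
    simp only [id_eq]
    field_simp
    simp
    ring
  have h0 : Tendsto (fun x : ℝ => x * Real.log x ^ 2) (𝓝[>] 0) (𝓝 0) := by
    have h1 := tendsto_log_mul_rpow_nhdsGT_zero (r := 1 / 2) (by norm_num)
    have h2 := h1.mul h1
    rw [mul_zero] at h2
    refine h2.congr' ?_
    filter_upwards [self_mem_nhdsWithin] with x hx
    have h3 : x ^ (1 / 2 : ℝ) * x ^ (1 / 2 : ℝ) = x := by
      rw [← Real.rpow_add hx]; norm_num
    calc _ = (x ^ (1 / 2 : ℝ) * x ^ (1 / 2 : ℝ)) * Real.log x ^ 2 := by ring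
      _ = _ := by rw [h3]
  have hG0 : Tendsto G (𝓝[>] 0) (𝓝 0) := by
    have h1 : Tendsto (fun x : ℝ => x * Real.log x) (𝓝[>] 0) (𝓝 0) := by
      have := (Real.continuous_mul_log.tendsto 0).mono_left (nhdsWithin_le_nhds (s := Ioi 0))
      simpa using this
    have h2 : Tendsto (fun x : ℝ => x) (𝓝[>] 0) (𝓝 0) := nhdsWithin_le_nhds
    simpa using (h0.sub (h1.const_mul 2)).add (h2.const_mul 2)
  have hG1 : Tendsto G (𝓝[<] 1) (𝓝 2) := by
    have : ContinuousAt G 1 := by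
      have := Real.continuousAt_log one_ne_zero
      exact ((continuousAt_id.mul (this.pow 2)).sub
        (continuousAt_const.mul (continuousAt_id.mul this))).add
        (continuousAt_const.mul continuousAt_id)
    have h := this.tendsto.mono_left (nhdsWithin_le_nhds (s := Iio 1))
    have e : G 1 = 2 := by simp [hG]
    rwa [e] at h
  have hint : IntervalIntegrable (fun x : ℝ => Real.log x ^ 2) volume 0 1 := by
    obtain ⟨C, hC⟩ : ∃ C : ℝ, ∀ x ∈ Ioc (0 : ℝ) 1, Real.log x ^ 2 ≤ C * x ^ (-(1 / 2) : ℝ) := by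
      refine ⟨16, fun x hx => ?_⟩
      -- The bound `|log x| x^(1/4) < 4`, squared, gives the integrable majorant `16 x^(-1/2)`.
      have h1 := Real.abs_log_mul_self_rpow_lt x (1 / 4) hx.1 hx.2 (by norm_num)
      have h2 : (Real.log x * x ^ (1 / 4 : ℝ)) ^ 2 ≤ 16 := by
        rw [← sq_abs]
        have : |Real.log x * x ^ (1 / 4 : ℝ)| ≤ 4 := by norm_num at h1 ⊢; exact h1.le
        nlinarith [abs_nonneg (Real.log x * x ^ (1 / 4 : ℝ))]
      have h3 : (x ^ (1 / 4 : ℝ)) ^ 2 = x ^ (1 / 2 : ℝ) := by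
        rw [← Real.rpow_natCast, ← Real.rpow_mul hx.1.le]; norm_num
      rw [mul_pow, h3] at h2
      rw [Real.rpow_neg hx.1.le, ← div_eq_mul_inv, le_div_iff₀ (Real.rpow_pos_of_pos hx.1 _)]
      exact h2
    have hb : IntervalIntegrable (fun x : ℝ => C * x ^ (-(1 / 2) : ℝ)) volume 0 1 :=
      (intervalIntegral.intervalIntegrable_rpow' (by norm_num)).const_mul C
    refine hb.mono_fun ?_ ?_
    · exact (Real.measurable_log.pow_const 2).aestronglyMeasurable
    · rw [uIoc_of_le zero_le_one]
      refine (ae_restrict_mem measurableSet_Ioc).mono fun x hx => ?_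
      beta_reduce
      rw [Real.norm_of_nonneg (sq_nonneg _)]
      exact (hC x hx).trans (le_abs_self _)
  rw [intervalIntegral.integral_eq_sub_of_hasDerivAt_of_tendsto zero_lt_one hderiv hint hG0 hG1]
  norm_num

/-- For `ρ ≠ 0` the inner integral is `(1 - x^ρ) / ρ`; after squaring, `x^(2ρ)` is integrable at 0
because `2ρ > -1`. -/
theorem integral_sq_integral_rpow {ρ : ℝ} (hρ : -(1 / 2) < ρ) :
    ∫ x in (0 : ℝ)..1, (∫ z in x..1, z ^ (ρ - 1)) ^ 2 = 2 / ((1 + ρ) * (1 + 2 * ρ)) := by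
  rw [intervalIntegral.integral_of_le zero_le_one]
  rcases eq_or_ne ρ 0 with rfl | hρ0
  · rw [setIntegral_congr_fun (g := fun x => Real.log x ^ 2) measurableSet_Ioc,
      ← intervalIntegral.integral_of_le zero_le_one, integral_log_sq]
    · norm_num
    · intro x hx
      have h1 : ∫ z in x..1, z ^ ((0 : ℝ) - 1) = Real.log (1 / x) := by
        rw [← integral_inv_of_pos hx.1 one_pos]
        simp [Real.rpow_neg_one]
      simp only [h1, one_div, Real.log_inv, neg_sq]
  · have h1 : ∀ x ∈ Ioc (0 : ℝ) 1, (∫ z in x..1, z ^ (ρ - 1)) ^ 2 =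
        (ρ ^ 2)⁻¹ * (1 - 2 * x ^ ρ + x ^ (2 * ρ)) := by
      intro x hx
      have hne : ρ - 1 ≠ -1 := fun h => hρ0 (by linarith)
      rw [integral_rpow (Or.inr ⟨hne, fun h => ?_⟩), sub_add_cancel, Real.one_rpow, mul_comm 2 ρ,
        Real.rpow_mul hx.1.le, Real.rpow_two]
      · field_simp
        ring
      · rw [uIcc_of_le hx.2] at h
        exact absurd h.1 (not_le.2 hx.1)
    rw [setIntegral_congr_fun measurableSet_Ioc h1,
      ← intervalIntegral.integral_of_le zero_le_one, intervalIntegral.integral_const_mul,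
      intervalIntegral.integral_add, intervalIntegral.integral_sub,
      intervalIntegral.integral_const_mul, integral_rpow (Or.inl (by linarith)),
      integral_rpow (Or.inl (by linarith))]
    · have h2 : 1 + ρ ≠ 0 := by linarith
      have h3 : 1 + ρ * 2 ≠ 0 := by linarith
      have h2' : ρ + 1 ≠ 0 := by linarith
      have h3' : 2 * ρ + 1 ≠ 0 := by linarith
      simp only [Real.one_rpow, Real.zero_rpow h2', Real.zero_rpow h3',
        intervalIntegral.integral_const, smul_eq_mul]
      rw [add_comm ρ 1, add_comm (2 * ρ) 1]
      field_simp
      ring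
    · exact intervalIntegrable_const
    · exact (intervalIntegral.intervalIntegrable_rpow' (by linarith)).const_mul 2
    · exact intervalIntegrable_const.sub
        ((intervalIntegral.intervalIntegrable_rpow' (by linarith)).const_mul 2)
    · exact intervalIntegral.intervalIntegrable_rpow' (by linarith)

variable {P : Measure ℝ} {γ p ρ : ℝ} {Lbar lbar : ℝ → ℝ}

/-- A Karamata-type limit for the centering. -/
theorem tendsto_integral_JFun_mul (hF : MemR γ P) (hγ : 0 < γ) (hp : 0 < p)
    (hL : LbarCond Lbar ρ lbar) :
    Tendsto (fun t => (∫ x in (0 : ℝ)..1, JFun ρ lbar (x * t) * logTail P (x * t) ^ p) /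
      (JFun ρ lbar t * (-Real.log t) ^ p)) (𝓝[>] 0) (𝓝 (γ ^ p / (ρ + 1))) := by
  have h0 : ∀ x < 1, cdf P x = 0 := fun _ => hF.cdf_eq_zero
  have hρ := hL.rho_gt
  -- With `r < 1/2` for `J` and exponent `1/4` for the logarithmic factor, the majorant `x^(-r -
  -- 1/4)` is integrable on `(0, 1)`.
  obtain ⟨r, hr1, hr2⟩ := exists_between (show -ρ < 1 / 2 by linarith)
  obtain ⟨t₁, ht₁, hJ⟩ := hL.JFun_le hr1
  obtain ⟨B, hB, t₂, ht₂, hq⟩ := hF.exists_logTail_rpow_bound hγ hp (η := 1 / 4) (by norm_num)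
  have hlim1 : Tendsto (fun t => (logTail P t / -Real.log t) ^ p) (𝓝[>] 0) (𝓝 (γ ^ p)) :=
    (hF.tendsto_logTail_div hγ).rpow_const (Or.inl hγ.ne')
  have hlog : ∀ᶠ t in 𝓝[>] 0, 0 < -Real.log t :=
    tendsto_neg_log_nhdsGT_zero.eventually_gt_atTop 0
  have hval : γ ^ p / (ρ + 1) = ∫ x in (0 : ℝ)..1, x ^ ρ * (1 ^ p * γ ^ p) := by
    have h2 : ρ + 1 ≠ 0 := by linarith
    rw [intervalIntegral.integral_mul_const, integral_rpow (Or.inl (by linarith)),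
      Real.zero_rpow h2, Real.one_rpow, Real.one_rpow]
    ring
  rw [hval]
  have key : Tendsto (fun t => ∫ x in (0 : ℝ)..1, JFun ρ lbar (x * t) / JFun ρ lbar t *
      (logTail P (x * t) ^ p / (-Real.log t) ^ p)) (𝓝[>] 0)
      (𝓝 (∫ x in (0 : ℝ)..1, x ^ ρ * (1 ^ p * γ ^ p))) := by
    refine intervalIntegral.tendsto_integral_filter_of_dominated_convergence
      (fun x => B * (γ ^ p + 1) * x ^ (-r + -(1 / 4))) ?_ ?_ ?_ ?_
    · filter_upwards [eventually_mem_Ioo_zero one_pos] with t ht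
      rw [uIoc_of_le zero_le_one]
      have hmaps : ∀ x ∈ Ioc (0 : ℝ) 1, x * t ∈ Ioo (0 : ℝ) 1 := fun x hx =>
        ⟨mul_pos hx.1 ht.1, by nlinarith [hx.1, hx.2, ht.1, ht.2]⟩
      have hc : ContinuousOn (fun x => JFun ρ lbar (x * t) / JFun ρ lbar t) (Ioc 0 1) :=
        (hL.continuousOn_JFun.comp (by fun_prop) hmaps).div_const _
      have ha : AntitoneOn (fun x => logTail P (x * t) ^ p) (Ioc 0 1) := fun a ha b hb hab =>
        Real.rpow_le_rpow (logTail_nonneg h0 (hmaps b hb)) (antitoneOn_logTail h0 (hmaps a ha)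
          (hmaps b hb) (mul_le_mul_of_nonneg_right hab ht.1.le)) hp.le
      exact (hc.aestronglyMeasurable measurableSet_Ioc).mul
        ((aemeasurable_restrict_of_antitoneOn measurableSet_Ioc ha).div_const
          _).aestronglyMeasurable
    · filter_upwards [eventually_mem_Ioo_zero (lt_min ht₁.1 ht₂.1), hlog,
        (tendsto_order.1 hlim1).2 (γ ^ p + 1) (by linarith)] with t ht hlt hqt
      refine Eventually.of_forall fun x hx => ?_
      rw [uIoc_of_le zero_le_one] at hx
      have ht1 : t < t₁ := ht.2.trans_le (min_le_left _ _)
      have ht2 : t < t₂ := ht.2.trans_le (min_le_right _ _)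
      have hmem : t ∈ Ioo (0 : ℝ) 1 := ⟨ht.1, ht1.trans ht₁.2⟩
      have hxt : x * t ≤ t := by nlinarith [hx.1, hx.2, ht.1]
      have hxt0 : 0 < x * t := mul_pos hx.1 ht.1
      obtain ⟨hJt, hJx⟩ := hJ t ⟨ht.1, ht1⟩
      have hJx0 := (hJ (x * t) ⟨hxt0, hxt.trans_lt ht1⟩).1
      have hlp := Real.rpow_pos_of_pos hlt p
      have b1 : JFun ρ lbar (x * t) / JFun ρ lbar t ≤ x ^ (-r) :=
        (div_le_iff₀ hJt).2 (hJx x hx)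
      have b2 : logTail P (x * t) ^ p / (-Real.log t) ^ p ≤
          B * x ^ (-(1 / 4) : ℝ) * (γ ^ p + 1) := by
        rw [Real.div_rpow (logTail_nonneg h0 hmem) hlt.le, div_lt_iff₀ hlp] at hqt
        rw [div_le_iff₀ hlp]
        have hx4 := Real.rpow_pos_of_pos hx.1 (-(1 / 4))
        calc _ ≤ B * x ^ (-(1 / 4) : ℝ) * logTail P t ^ p := hq t ⟨ht.1, ht2⟩ x hx
          _ ≤ B * x ^ (-(1 / 4) : ℝ) * ((γ ^ p + 1) * (-Real.log t) ^ p) := by gcongr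
          _ = _ := by ring
      have b3 : 0 ≤ logTail P (x * t) ^ p / (-Real.log t) ^ p :=
        div_nonneg (Real.rpow_nonneg (logTail_nonneg h0 ⟨hxt0, hxt.trans_lt hmem.2⟩) _) hlp.le
      rw [norm_mul, Real.norm_of_nonneg (div_pos hJx0 hJt).le, Real.norm_of_nonneg b3,
        Real.rpow_add hx.1]
      calc _ ≤ x ^ (-r) * (B * x ^ (-(1 / 4) : ℝ) * (γ ^ p + 1)) :=
            mul_le_mul b1 b2 b3 (Real.rpow_nonneg hx.1.le _)
        _ = _ := by ring
    · exact (intervalIntegral.intervalIntegrable_rpow' (by linarith)).const_mul _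
    · refine Eventually.of_forall fun x hx => ?_
      rw [uIoc_of_le zero_le_one] at hx
      refine (hL.tendsto_JFun_ratio hx.1).mul ?_
      refine (((hF.tendsto_logTail_ratio hγ hx.1 hx.2).rpow_const
        (Or.inl one_ne_zero)).mul hlim1).congr' ?_
      filter_upwards [eventually_mem_Ioo_zero one_pos, hlog,
        hF.tendsto_logTail_atTop.eventually_gt_atTop 0] with t ht hlt hqt
      have hm : x * t ∈ Ioo (0 : ℝ) 1 :=
        ⟨mul_pos hx.1 ht.1, by nlinarith [hx.1, hx.2, ht.1, ht.2]⟩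
      rw [Real.div_rpow (logTail_nonneg h0 hm) hqt.le, Real.div_rpow hqt.le hlt.le]
      have := (Real.rpow_pos_of_pos hqt p).ne'
      field_simp
  refine key.congr fun t => ?_
  rw [← intervalIntegral.integral_div]
  exact intervalIntegral.integral_congr fun x _ => div_mul_div_comm _ _ _ _

/-- The asymptotics of the variance along sequences of intervals `[s n, a n)`. -/
theorem tendsto_variance (hF : MemR γ P) (hγ : 0 < γ) (hp : 0 < p)
    (hL : LbarCond Lbar ρ lbar) {s a : ℕ → ℝ} (ha : Tendsto a atTop (𝓝[>] 0))
    (hs : ∀ᶠ n in atTop, 0 < s n) (hsa : Tendsto (fun n => s n / a n) atTop (𝓝 0)) :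
    Tendsto (fun n =>
      (∫ x in (0 : ℝ)..1, ((KFun P p ρ lbar (a n) - KFun P p ρ lbar (max (s n) (x * a n))) /
        (JFun ρ lbar (a n) * (-Real.log (a n)) ^ (p - 1))) ^ 2) -
      a n * (∫ x in (0 : ℝ)..1, (KFun P p ρ lbar (a n) - KFun P p ρ lbar (max (s n) (x * a n))) /
        (JFun ρ lbar (a n) * (-Real.log (a n)) ^ (p - 1))) ^ 2) atTop
      (𝓝 ((p * γ ^ p) ^ 2 * (2 / ((1 + ρ) * (1 + 2 * ρ))))) := by
  have h0 : ∀ x < 1, cdf P x = 0 := fun _ => hF.cdf_eq_zero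
  have hρ := hL.rho_gt
  -- `β < 1/2` makes the squared majorant `x^(-2β)` integrable; `ρ > -1/2` leaves room for such a `β
  -- > -ρ`.
  obtain ⟨β, hβ1, hβ2⟩ := exists_between (max_lt (show (0 : ℝ) < 1 / 2 by norm_num)
    (show -ρ < 1 / 2 by linarith))
  have hβ0 : 0 < β := (le_max_left _ _).trans_lt hβ1
  obtain ⟨B, hB, t₀, ht₀, hK⟩ :=
    exists_KFun_sub_bound hF hγ hp hL hβ0 ((le_max_right _ _).trans_lt hβ1)
  obtain ⟨t₁, ht₁, hJ⟩ := hL.JFun_le (r := -ρ + 1) (by linarith)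
  set N : ℕ → ℝ → ℝ := fun n x =>
    (KFun P p ρ lbar (a n) - KFun P p ρ lbar (max (s n) (x * a n))) /
        (JFun ρ lbar (a n) * (-Real.log (a n)) ^ (p - 1)) with hN
  have hsa1 : ∀ᶠ n in atTop, s n ≤ a n := by
    filter_upwards [(tendsto_order.1 hsa).2 1 one_pos, ha self_mem_nhdsWithin] with n h1 h2
    exact ((div_lt_one h2).1 h1).le
  have hmem : ∀ᶠ n in atTop, ∀ x ∈ Ioc (0 : ℝ) 1, max (s n) (x * a n) ∈ Ioo (0 : ℝ) 1 := by
    filter_upwards [ha (eventually_mem_Ioo_zero one_pos), hs, hsa1] with n h1 h2 h3 x hx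
    have h1' : a n ∈ Ioo (0 : ℝ) 1 := h1
    exact ⟨lt_max_of_lt_left h2, max_lt (h3.trans_lt h1'.2)
      (by nlinarith [hx.1, hx.2, h1'.1, h1'.2])⟩
  have hmeas : ∀ᶠ n in atTop, AEStronglyMeasurable (N n) (volume.restrict (uIoc 0 1)) := by
    filter_upwards [hmem, ha self_mem_nhdsWithin] with n h1 h2
    have h2' : 0 < a n := h2
    rw [uIoc_of_le zero_le_one]
    have hmono : MonotoneOn (fun x => KFun P p ρ lbar (max (s n) (x * a n))) (Ioc 0 1) :=
      fun x hx y hy hxy => monotoneOn_KFun h0 hp hL (h1 x hx) (h1 y hy)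
        (max_le_max le_rfl (mul_le_mul_of_nonneg_right hxy h2'.le))
    exact (((aemeasurable_restrict_of_monotoneOn measurableSet_Ioc hmono).const_sub _).div_const
      _).aestronglyMeasurable
  have hbound : ∀ᶠ n in atTop, ∀ x ∈ Ioc (0 : ℝ) 1, 0 ≤ N n x ∧ N n x ≤ B * x ^ (-β) := by
    filter_upwards [hmem, hs, hsa1, ha (eventually_mem_Ioo_zero (lt_min ht₀.1 ht₁.1)),
      (tendsto_neg_log_nhdsGT_zero.comp ha).eventually_gt_atTop 0] with n h1 h2 h3 h4 h5 x hx
    have h4' : a n ∈ Ioo 0 (min t₀ t₁) := h4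
    have ha0 := h4'.1
    have hJn := (hJ (a n) ⟨ha0, h4'.2.trans_le (min_le_right _ _)⟩).1
    have hD : 0 < JFun ρ lbar (a n) * (-Real.log (a n)) ^ (p - 1) :=
      mul_pos hJn (Real.rpow_pos_of_pos h5 _)
    have ha1 : a n < 1 := (h4'.2.trans_le (min_le_left _ _)).trans ht₀.2
    have hxa : x * a n ≤ a n := by nlinarith [hx.1, hx.2]
    have hxa0 : 0 < x * a n := mul_pos hx.1 ha0
    refine ⟨div_nonneg (KFun_sub_nonneg h0 hp hL (h1 x hx).1 (max_le h3 hxa) ha1) hD.le, ?_⟩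
    rw [div_le_iff₀ hD]
    refine le_trans ?_ (hK (a n) ⟨ha0, h4'.2.trans_le (min_le_left _ _)⟩ x hx)
    exact sub_le_sub_left (monotoneOn_KFun h0 hp hL ⟨hxa0, hxa.trans_lt ha1⟩ (h1 x hx)
      (le_max_right _ _)) _
  have hpt : ∀ x ∈ Ioc (0 : ℝ) 1,
      Tendsto (fun n => N n x) atTop (𝓝 (p * γ ^ p * ∫ z in x..1, z ^ (ρ - 1))) := by
    intro x hx
    refine ((tendsto_KFun_sub hF hγ hp hL hx.1 hx.2).comp ha).congr' ?_
    -- For fixed `x` the truncation at `s n` eventually disappears, because `s n / a n < x`.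
    filter_upwards [(tendsto_order.1 hsa).2 x hx.1, ha self_mem_nhdsWithin] with n h1 h2
    have h3 : s n ≤ x * a n := ((div_lt_iff₀ h2).1 h1).le
    simp only [hN, Function.comp_apply, max_eq_right h3]
  have h1 : Tendsto (fun n => ∫ x in (0 : ℝ)..1, N n x) atTop
      (𝓝 (∫ x in (0 : ℝ)..1, p * γ ^ p * ∫ z in x..1, z ^ (ρ - 1))) := by
    refine intervalIntegral.tendsto_integral_filter_of_dominated_convergence
      (fun x => B * x ^ (-β)) hmeas ?_ ?_ ?_
    · filter_upwards [hbound] with n hn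
      refine Eventually.of_forall fun x hx => ?_
      rw [uIoc_of_le zero_le_one] at hx
      rw [Real.norm_of_nonneg (hn x hx).1]
      exact (hn x hx).2
    · exact (intervalIntegral.intervalIntegrable_rpow' (by linarith)).const_mul _
    · refine Eventually.of_forall fun x hx => ?_
      rw [uIoc_of_le zero_le_one] at hx
      exact hpt x hx
  have h2 : Tendsto (fun n => ∫ x in (0 : ℝ)..1, N n x ^ 2) atTop
      (𝓝 (∫ x in (0 : ℝ)..1, (p * γ ^ p * ∫ z in x..1, z ^ (ρ - 1)) ^ 2)) := by
    refine intervalIntegral.tendsto_integral_filter_of_dominated_convergence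
      (fun x => B ^ 2 * x ^ (-β * 2)) (hmeas.mono fun n hn => hn.pow 2) ?_ ?_ ?_
    · filter_upwards [hbound] with n hn
      refine Eventually.of_forall fun x hx => ?_
      rw [uIoc_of_le zero_le_one] at hx
      rw [Real.norm_of_nonneg (sq_nonneg _), Real.rpow_mul hx.1.le, Real.rpow_two, ← mul_pow]
      exact pow_le_pow_left₀ (hn x hx).1 (hn x hx).2 2
    · exact (intervalIntegral.intervalIntegrable_rpow' (by linarith)).const_mul _
    · refine Eventually.of_forall fun x hx => ?_
      rw [uIoc_of_le zero_le_one] at hx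
      exact (hpt x hx).pow 2
  have ha0 : Tendsto a atTop (𝓝 0) := tendsto_nhds_of_tendsto_nhdsWithin ha
  have h3 := h2.sub (ha0.mul (h1.pow 2))
  have e : ∫ x in (0 : ℝ)..1, (p * γ ^ p * ∫ z in x..1, z ^ (ρ - 1)) ^ 2 =
      (p * γ ^ p) ^ 2 * (2 / ((1 + ρ) * (1 + 2 * ρ))) := by
    simp only [mul_pow (p * γ ^ p)]
    rw [intervalIntegral.integral_const_mul, integral_sq_integral_rpow hρ]
  rwa [zero_mul, sub_zero, e] at h3

/-! ### Passage to the sequences `1/n` and `k_n/n`. -/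

theorem KCond.tendsto_ratio {k : ℕ → ℕ} (hk : KCond k) :
    Tendsto (fun n : ℕ => (k n : ℝ) / n) atTop (𝓝[>] 0) := by
  refine tendsto_nhdsWithin_iff.2 ⟨hk.ratio, ?_⟩
  filter_upwards [eventually_ge_atTop 2] with n hn
  have h1 : (0 : ℝ) < k n := by exact_mod_cast (hk.bounds n hn).1
  have h2 : (0 : ℝ) < n := by exact_mod_cast (by omega : 0 < n)
  exact div_pos h1 h2

theorem tendsto_sigma_div (hF : MemR γ P) (hγ : 0 < γ) (hp : 0 < p) (hL : LbarCond Lbar ρ lbar)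
    {k : ℕ → ℕ} (hk : KCond k) :
    Tendsto (fun n : ℕ => sigma P p ρ lbar (1 / (n : ℝ)) ((k n : ℝ) / n) /
      (p * γ ^ p * (2 / ((1 + ρ) * (1 + 2 * ρ))) ^ (1 / 2 : ℝ) *
        ((k n : ℝ) / n) ^ (ρ + 1 / 2) * Real.log ((n : ℝ) / k n) ^ (p - 1) *
        lbar ((k n : ℝ) / n))) atTop (𝓝 1) := by
  have h0 : ∀ x < 1, cdf P x = 0 := fun _ => hF.cdf_eq_zero
  have hρ := hL.rho_gt
  set a : ℕ → ℝ := fun n => (k n : ℝ) / n with ha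
  have hat : Tendsto a atTop (𝓝[>] 0) := hk.tendsto_ratio
  have hs : ∀ᶠ n : ℕ in atTop, (0 : ℝ) < 1 / (n : ℝ) := by
    filter_upwards [eventually_gt_atTop 0] with n hn
    positivity
  -- The ratio of the endpoints is `1 / k_n`, so `k_n → ∞` is what makes the lower endpoint
  -- negligible.
  have hsa : Tendsto (fun n : ℕ => 1 / (n : ℝ) / a n) atTop (𝓝 0) := by
    have h1 : Tendsto (fun n => ((k n : ℝ))⁻¹) atTop (𝓝 0) :=
      tendsto_inv_atTop_zero.comp (tendsto_natCast_atTop_atTop.comp hk.tendsto_top)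
    refine h1.congr' ?_
    filter_upwards [eventually_gt_atTop 0] with n hn
    have : (n : ℝ) ≠ 0 := by positivity
    simp only [ha]
    field_simp
  set c : ℝ := 2 / ((1 + ρ) * (1 + 2 * ρ)) with hc
  have hc0 : 0 < c := div_pos two_pos (mul_pos (by linarith) (by linarith))
  have hC0 : 0 < p * γ ^ p := mul_pos hp (Real.rpow_pos_of_pos hγ _)
  have h1 := ((tendsto_variance hF hγ hp hL hat hs hsa).sqrt).div_const (p * γ ^ p * √c)
  have e : √((p * γ ^ p) ^ 2 * c) / (p * γ ^ p * √c) = 1 := by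
    rw [Real.sqrt_mul (sq_nonneg _), Real.sqrt_sq hC0.le]
    exact div_self (mul_pos hC0 (Real.sqrt_pos.2 hc0)).ne'
  rw [e] at h1
  refine h1.congr' ?_
  obtain ⟨t₁, ht₁, hJ⟩ := hL.JFun_le (r := -ρ + 1) (by linarith)
  filter_upwards [hat (eventually_mem_Ioo_zero ht₁.1), hs, (tendsto_order.1 hsa).2 1 one_pos,
    (tendsto_neg_log_nhdsGT_zero.comp hat).eventually_gt_atTop 0] with n h2 h3 h4 h5
  have h2' : a n ∈ Ioo 0 t₁ := h2
  have ha0 := h2'.1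
  have hJn := (hJ (a n) h2').1
  have hlp : 0 < (-Real.log (a n)) ^ (p - 1) := Real.rpow_pos_of_pos h5 _
  rw [sigma_eq h0 hp hL h3 ((div_lt_one ha0).1 h4).le (h2'.2.trans ht₁.2)]
  have hlog : Real.log ((n : ℝ) / k n) = -Real.log (a n) := by
    rw [← Real.log_inv]; simp [ha]
  have hsub : ∀ f : ℝ → ℝ, ∫ w in (0 : ℝ)..a n, f w = a n * ∫ x in (0 : ℝ)..1, f (x * a n) := by
    intro f
    have := intervalIntegral.mul_integral_comp_mul_right (a := 0) (b := 1) (f := f) (a n)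
    rw [this, zero_mul, one_mul]
  rw [hlog, hsub fun w => (KFun P p ρ lbar (a n) - KFun P p ρ lbar (max (1 / (n : ℝ)) w)) ^ 2,
    hsub fun w => KFun P p ρ lbar (a n) - KFun P p ρ lbar (max (1 / (n : ℝ)) w)]
  set D : ℝ := JFun ρ lbar (a n) * (-Real.log (a n)) ^ (p - 1) with hD
  have hD0 : 0 < D := mul_pos hJn hlp
  simp only [div_pow, intervalIntegral.integral_div]
  generalize ∫ x in (0 : ℝ)..1,
    (KFun P p ρ lbar (a n) - KFun P p ρ lbar (max (1 / (n : ℝ)) (x * a n))) ^ 2 = I₂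
  generalize ∫ x in (0 : ℝ)..1,
    (KFun P p ρ lbar (a n) - KFun P p ρ lbar (max (1 / (n : ℝ)) (x * a n))) = I₁
  -- Pulling out `a D²` leaves the normalized variance of `tendsto_variance`; its square root `√a ·
  -- D` carries the power `a^(ρ + 1/2)` of the claimed rate.
  have e1 : a n * I₂ - (a n * I₁) ^ 2 = (a n * D ^ 2) * (I₂ / D ^ 2 - a n * (I₁ ^ 2 / D ^ 2)) := by
    field_simp
  have e2 : p * γ ^ p * c ^ (1 / 2 : ℝ) * a n ^ (ρ + 1 / 2) * (-Real.log (a n)) ^ (p - 1) *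
      lbar (a n) = (p * γ ^ p * √c) * (√(a n) * D) := by
    rw [Real.rpow_add ha0, ← Real.sqrt_eq_rpow, ← Real.sqrt_eq_rpow, hD, JFun]
    ring
  rw [e1, e2, Real.sqrt_mul (by positivity), Real.sqrt_mul ha0.le, Real.sqrt_sq hD0.le,
    mul_comm (p * γ ^ p * √c), mul_div_mul_left]
  exact (mul_pos (Real.sqrt_pos.2 ha0) hD0).ne'

theorem tendsto_muSeq_div (hF : MemR γ P) (hγ : 0 < γ) (hp : 0 < p) (hL : LbarCond Lbar ρ lbar)
    {k : ℕ → ℕ} (hk : KCond k) :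
    Tendsto (fun n : ℕ => muSeq P p ρ lbar k n / (γ ^ p * alphaSeq p ρ lbar k n)) atTop
      (𝓝 1) := by
  have hρ := hL.rho_gt
  have hat := hk.tendsto_ratio
  have hγp := Real.rpow_pos_of_pos hγ p
  have h1 := ((tendsto_integral_JFun_mul hF hγ hp hL).comp hat).div_const (γ ^ p / (ρ + 1))
  have hρ1 : ρ + 1 ≠ 0 := by linarith
  rw [div_self (div_ne_zero hγp.ne' hρ1)] at h1
  refine h1.congr' ?_
  filter_upwards [eventually_ge_atTop 2] with n hn
  have hk0 : (k n : ℝ) ≠ 0 := by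
    have := (hk.bounds n hn).1
    positivity
  have hn0 : (n : ℝ) ≠ 0 := by positivity
  have hlog : Real.log ((n : ℝ) / k n) = -Real.log ((k n : ℝ) / n) := by
    rw [← Real.log_inv, inv_div]
  have hsub := intervalIntegral.mul_integral_comp_mul_right (a := 0) (b := 1)
    (f := fun u => JFun ρ lbar u * gFun P p u) ((k n : ℝ) / n)
  rw [zero_mul, one_mul] at hsub
  rw [muSeq, alphaSeq, ← hsub, hlog]
  simp only [gFun_eq, mul_neg, intervalIntegral.integral_neg, Function.comp_apply]
  generalize ∫ x in (0 : ℝ)..1, JFun ρ lbar (x * ((k n : ℝ) / n)) *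
    logTail P (x * ((k n : ℝ) / n)) ^ p = I
  field_simp

end PowerSums

end

theorem proposition1 (γ p ρ : ℝ) (hγ : 0 < γ) (hp : 0 < p)
    (P : MeasureTheory.Measure ℝ) [MeasureTheory.IsProbabilityMeasure P]
    (hF : PowerSums.MemR γ P)
    (k : ℕ → ℕ) (hk : PowerSums.KCond k)
    (Lbar lbar : ℝ → ℝ) (hL : PowerSums.LbarCond Lbar ρ lbar) :
    Filter.Tendsto (fun n : ℕ =>
        PowerSums.sigma P p ρ lbar (1 / (n : ℝ)) ((k n : ℝ) / n) /
          (p * γ ^ p * (2 / ((1 + ρ) * (1 + 2 * ρ))) ^ (1 / 2 : ℝ) *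
            ((k n : ℝ) / n) ^ (ρ + 1 / 2) * Real.log ((n : ℝ) / k n) ^ (p - 1) *
            lbar ((k n : ℝ) / n)))
      Filter.atTop (nhds 1) ∧
    Filter.Tendsto (fun n : ℕ =>
        PowerSums.muSeq P p ρ lbar k n / (γ ^ p * PowerSums.alphaSeq p ρ lbar k n))
      Filter.atTop (nhds 1) :=
  ⟨PowerSums.tendsto_sigma_div hF hγ hp hL hk, PowerSums.tendsto_muSeq_div hF hγ hp hL hk⟩
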